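/- **Setting.** Let $N=\{1,\dots,n\}$ be a finite set of agents and $D=\{0,1\}$ the set of alternatives. Each agent $a\in N$ casts a ballot $B_a(0)\succ\dots\succ B_a(k_a-1)\succ B_a(k_a)$, where $k_a\ge 0$, the entries $B_a(0),\dots,B_a(k_a-1)$ are pairwise distinct agents in $N\setminus\{a\}$, and $B_a(k_a)\in D$. The delegation graph has vertex set $V=N\sqcup D\sqcup\{r\}$, an edge $d\to r$ of cost $0$ for each $d\in D$, and an edge $a\to B_a(i)$ of cost $i$ for each $a\in N$ and $0\le i\le k_a$; let $E$ be its edge set. An arborescence is a set $T\subseteq E$ that is a directed spanning tree with sink $r$: each vertex other than $r$ has exactly one outgoing edge in $T$, $r$ has none, and every vertex reaches $r$ along $T$. Its cost is the sum of the costs of its edges. Arborescences correspond to choices of a position $c_a\in\{0,\dots,k_a\}$ for each agent, via $T_c=\{(a,B_a(c_a)) : a\in N\}\cup\{(0,r),(1,r)\}$. Agent $a$ votes $d\in D$ in $T$ if $d$ lies on the path from $a$ to $r$ in $T$. For $L\subseteq V$ let $\rho(L)=\{(u,v)\in E : u\in L,\ v\notin L\}$. Fulkerson's algorithm starts with $E'=\varnothing$,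 $\mathcal L=\varnothing$ and $w$ the edge costs. While there is a strongly connected component $L$ of $(V,E')$ with $r\notin L$ and $\rho(L)\cap E'=\varnothing$, it picks any such $L$, adds $L$ to $\mathcal L$, subtracts $\min_{e\in\rho(L)}w(e)$ from $w(e)$ for every $e\in\rho(L)$, and then adds to $E'$ all $e\in\rho(L)$ with $w(e)=0$. It outputs $E'$ (the tight edges) and $\mathcal L$. **Theorem.** Let $N_1\subseteq N$ be the set of agents who vote $1$ in some minimum-cost arborescence of the delegation graph. 1. There is an algorithm that, given the ballots $(B_a)_{a\in N}$, computes in time polynomial in the size of the input a minimum-cost arborescence (given by its positions $(c_a)_{a\in N}$) in which all agents in $N_1$ vote $1$. 2. Fulkerson's algorithm on the delegation graph has an output, and for every output $(E',\mathcal L)$, whatever choices of $L$ are made, and every $a\in N$: $a\in N_1$ if and only if $1$ is reachable from $a$ along edges in $E'$. -/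

import Mathlib

namespace LiquidDemocracy

/-! ### Weighted digraphs and arborescences -/

/-- A finite directed graph without parallel edges, with natural edge weights and a distinguished
root. The value of `weight` outside `edges` is irrelevant. -/
structure WDigraph (V : Type*) where
  edges : Finset (V × V)
  weight : V × V → ℕ
  root : V

/-- `Reach T u v`: there is a (possibly empty) directed walk from `u` to `v` along edges in `T`. -/
def Reach {V : Type*} (T : Finset (V × V)) : V → V → Prop :=
  Relation.ReflTransGen fun u v => (u, v) ∈ T

/-- `T` is an arborescence of `G`: a directed spanning tree of `G` with sink the root. -/
structure IsArborescence {V : Type*} (G : WDigraph V) (T : Finset (V × V)) : Prop where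
  subset : T ⊆ G.edges
  root_no_out : ∀ v, (G.root, v) ∉ T
  unique_out : ∀ u, u ≠ G.root → ∃! v, (u, v) ∈ T
  reach_root : ∀ u, Reach T u G.root

/-- The total cost of a set of edges. -/
def WDigraph.cost {V : Type*} (G : WDigraph V) (T : Finset (V × V)) : ℕ :=
  ∑ e ∈ T, G.weight e

/-- `T` is an arborescence of `G` of minimum cost. -/
def IsMinCostArborescence {V : Type*} (G : WDigraph V) (T : Finset (V × V)) : Prop :=
  IsArborescence G T ∧ ∀ T', IsArborescence G T' → G.cost T ≤ G.cost T'

/-! ### Fulkerson's algorithm -/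

/-- `ρ(L)`: the edges of `G` that leave `L`. -/
def WDigraph.leaving {V : Type*} [DecidableEq V] (G : WDigraph V) (L : Finset V) :
    Finset (V × V) :=
  G.edges.filter fun e => e.1 ∈ L ∧ e.2 ∉ L

/-- `L` is a strongly connected component of the graph with edge set `E'`. -/
def IsSCC {V : Type*} (E' : Finset (V × V)) (L : Finset V) : Prop :=
  ∃ u, ∀ v, v ∈ L ↔ Reach E' u v ∧ Reach E' v u

/-- The variables of Fulkerson's algorithm: the tight edges found so far, the family of sets picked
so far, and the current (reduced) weights. -/
structure FulkersonState (V : Type*) where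
  tight : Finset (V × V)
  family : Finset (Finset V)
  weight : V × V → ℕ

/-- The state before the first iteration. -/
def FulkersonState.init {V : Type*} (G : WDigraph V) : FulkersonState V :=
  ⟨∅, ∅, G.weight⟩

/-- `L` satisfies the loop condition: it is a strongly connected component with respect to the tight
edges, it avoids the root, and no tight edge leaves it. -/
def FulkersonState.Eligible {V : Type*} [DecidableEq V] (G : WDigraph V) (s : FulkersonState V)
    (L : Finset V) : Prop :=
  IsSCC s.tight L ∧ G.root ∉ L ∧ G.leaving L ∩ s.tight = ∅

/-- The weights after subtracting `m` from all edges of `G` leaving `L`. -/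
def FulkersonState.reduce {V : Type*} [DecidableEq V] (G : WDigraph V) (s : FulkersonState V)
    (L : Finset V) (m : ℕ) : V × V → ℕ :=
  fun e => if e ∈ G.leaving L then s.weight e - m else s.weight e

/-- One iteration of the loop, with an arbitrary eligible `L`. Here `m` is the minimum current weight
of an edge leaving `L`, so the subtraction of natural numbers is exact. -/
inductive FulkersonStep {V : Type*} [DecidableEq V] (G : WDigraph V) :
    FulkersonState V → FulkersonState V → Prop
  | iter (s : FulkersonState V) (L : Finset V) (m : ℕ) (hL : s.Eligible G L)
      (hm : IsLeast {x | ∃ e ∈ G.leaving L, s.weight e = x} m) :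
      FulkersonStep G s
        { tight := s.tight ∪ (G.leaving L).filter fun e => s.reduce G L m e = 0
          family := insert L s.family
          weight := s.reduce G L m }

/-- `(E', F)` is an output of Fulkerson's algorithm on `G`, for some sequence of choices: it is read
off a state that is reachable from the initial one and in which the loop condition fails. -/
def IsFulkersonOutput {V : Type*} [DecidableEq V] (G : WDigraph V) (E' : Finset (V × V))
    (F : Finset (Finset V)) : Prop :=
  ∃ s : FulkersonState V,
    Relation.ReflTransGen (FulkersonStep G) (FulkersonState.init G) s ∧
    (¬ ∃ L, s.Eligible G L) ∧ s.tight = E' ∧ s.family = F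

/-! ### Ballots and the delegation graph -/

/-- The ranked ballot of agent `a` among `n` agents: a list of distinct other agents, most preferred
first, followed by a direct backup vote in `{0, 1}`. -/
structure Ballot (n : ℕ) (a : Fin n) where
  delegates : List (Fin n)
  nodup : delegates.Nodup
  notMem : a ∉ delegates
  backup : Fin 2

/-- A ballot for each of the `n` agents. -/
abbrev Profile (n : ℕ) := (a : Fin n) → Ballot n a

/-- The vertices of the delegation graph: agents, alternatives `0` and `1`, and the root. -/
inductive Vertex (n : ℕ) where
  | agent (a : Fin n)
  | alt (d : Fin 2)
  | root
  deriving DecidableEq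

/-- The number `k_a` of agents on the ballot. -/
def Ballot.size {n : ℕ} {a : Fin n} (b : Ballot n a) : ℕ := b.delegates.length

/-- The entry at position `0 ≤ i ≤ k_a` of the ballot; the one at `k_a` is the backup vote. -/
def Ballot.entry {n : ℕ} {a : Fin n} (b : Ballot n a) (i : Fin (b.size + 1)) : Vertex n :=
  if h : (i : ℕ) < b.delegates.length then .agent (b.delegates[(i : ℕ)]) else .alt b.backup

/-- The weight of the edge from `a` to an entry of its ballot is the position of that entry. -/
def Ballot.rank {n : ℕ} {a : Fin n} (b : Ballot n a) : Vertex n → ℕ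
  | .agent c => b.delegates.idxOf c
  | .alt _ => b.size
  | .root => 0

theorem Ballot.rank_entry {n : ℕ} {a : Fin n} (b : Ballot n a) (i : Fin (b.size + 1)) :
    b.rank (b.entry i) = i := by
  unfold Ballot.entry
  split_ifs with h
  · exact b.nodup.idxOf_getElem i h
  · have := i.2
    simp only [Ballot.rank, Ballot.size] at *
    omega

/-- The delegation graph: an edge of weight `0` from each alternative to the root, and an edge of
weight `i` from each agent to the entry at position `i` of its ballot. -/
def delegationGraph {n : ℕ} (B : Profile n) : WDigraph (Vertex n) where
  edges :=
    (Finset.univ.image fun d : Fin 2 => (Vertex.alt d, Vertex.root)) ∪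
      Finset.univ.biUnion fun a : Fin n =>
        Finset.univ.image fun i : Fin ((B a).size + 1) => (Vertex.agent a, (B a).entry i)
  weight
    | (.agent a, x) => (B a).rank x
    | _ => 0
  root := .root

/-- A certificate selects a position from each ballot. -/
abbrev Certificate {n : ℕ} (B : Profile n) := (a : Fin n) → Fin ((B a).size + 1)

/-- The set of edges selected by a certificate. -/
def certificateEdges {n : ℕ} (B : Profile n) (c : Certificate B) :
    Finset (Vertex n × Vertex n) :=
  (Finset.univ.image fun d : Fin 2 => (Vertex.alt d, Vertex.root)) ∪
    Finset.univ.image fun a : Fin n => (Vertex.agent a, (B a).entry (c a))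

/-- Agent `a` votes `d` in the arborescence `T`: the vertex `d` lies on the path in `T` that starts
at `a` (in an arborescence, this is the path from `a` to the root). -/
def Votes {n : ℕ} (T : Finset (Vertex n × Vertex n)) (a : Fin n) (d : Fin 2) : Prop :=
  Reach T (.agent a) (.alt d)

/-- `N₁`: the agents who vote `1` in some minimum-cost arborescence. -/
def supporters {n : ℕ} (B : Profile n) : Set (Fin n) :=
  {a | ∃ T, IsMinCostArborescence (delegationGraph B) T ∧ Votes T a 1}

/-! ### Random access machine programs with a step count

Programs act on natural-number registers and zero-initialised arrays, with addition, truncated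
subtraction and comparisons, but no multiplication. Every arithmetic operation, memory access,
assignment and test costs one step. Numbers gain at most one bit per step, so polynomial time here
agrees with polynomial time on Turing machines. -/

/-- Expressions: constants, registers, array cells with a computed index, and arithmetic. -/
inductive RExpr where
  | const (c : ℕ)
  | reg (x : ℕ)
  | cell (A : ℕ) (i : RExpr)
  | add (e f : RExpr)
  | sub (e f : RExpr)
  | lt (e f : RExpr)
  | eq (e f : RExpr)

/-- Programs. `setReg x e` stores `e` in register `x`; `setCell A i e` stores `e` in cell `i` of array
`A`. A test succeeds if its value is not `0`. -/
inductive Program where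
  | skip
  | setReg (x : ℕ) (e : RExpr)
  | setCell (A : ℕ) (i e : RExpr)
  | seq (p q : Program)
  | cond (b : RExpr) (p q : Program)
  | loop (b : RExpr) (p : Program)

/-- The contents of the registers and of the arrays. -/
structure Memory where
  regs : ℕ → ℕ
  arrays : ℕ → ℕ → ℕ

/-- The value of an expression. -/
def RExpr.eval (s : Memory) : RExpr → ℕ
  | .const c => c
  | .reg x => s.regs x
  | .cell A i => s.arrays A (i.eval s)
  | .add e f => e.eval s + f.eval s
  | .sub e f => e.eval s - f.eval s
  | .lt e f => if e.eval s < f.eval s then 1 else 0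
  | .eq e f => if e.eval s = f.eval s then 1 else 0

/-- The number of steps needed to evaluate an expression. -/
def RExpr.steps : RExpr → ℕ
  | .const _ => 1
  | .reg _ => 1
  | .cell _ i => i.steps + 1
  | .add e f => e.steps + f.steps + 1
  | .sub e f => e.steps + f.steps + 1
  | .lt e f => e.steps + f.steps + 1
  | .eq e f => e.steps + f.steps + 1

/-- Overwrite a register. -/
def Memory.setReg (s : Memory) (x v : ℕ) : Memory :=
  { s with regs := Function.update s.regs x v }

/-- Overwrite an array cell. -/
def Memory.setCell (s : Memory) (A i v : ℕ) : Memory :=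
  { s with arrays := Function.update s.arrays A (Function.update (s.arrays A) i v) }

/-- `Runs p s t s'`: started in memory `s`, the program `p` halts after exactly `t` steps, leaving
memory `s'`. -/
inductive Runs : Program → Memory → ℕ → Memory → Prop
  | skip (s : Memory) : Runs .skip s 1 s
  | setReg (s : Memory) (x : ℕ) (e : RExpr) :
      Runs (.setReg x e) s (e.steps + 1) (s.setReg x (e.eval s))
  | setCell (s : Memory) (A : ℕ) (i e : RExpr) :
      Runs (.setCell A i e) s (i.steps + e.steps + 1) (s.setCell A (i.eval s) (e.eval s))
  | seq {p q : Program} {s s' s'' : Memory} {t t' : ℕ}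
      (hp : Runs p s t s') (hq : Runs q s' t' s'') : Runs (.seq p q) s (t + t') s''
  | cond_true {b : RExpr} {p q : Program} {s s' : Memory} {t : ℕ}
      (hb : b.eval s ≠ 0) (hp : Runs p s t s') : Runs (.cond b p q) s (b.steps + 1 + t) s'
  | cond_false {b : RExpr} {p q : Program} {s s' : Memory} {t : ℕ}
      (hb : b.eval s = 0) (hq : Runs q s t s') : Runs (.cond b p q) s (b.steps + 1 + t) s'
  | loop_done {b : RExpr} {p : Program} {s : Memory}
      (hb : b.eval s = 0) : Runs (.loop b p) s (b.steps + 1) s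
  | loop_again {b : RExpr} {p : Program} {s s' s'' : Memory} {t t' : ℕ}
      (hb : b.eval s ≠ 0) (hp : Runs p s t s') (hl : Runs (.loop b p) s' t' s'') :
      Runs (.loop b p) s (b.steps + 1 + t + t') s''

/-- The initial memory: the input in array `0`, and `0` everywhere else. -/
def Memory.ofInput (l : List ℕ) : Memory where
  regs := fun _ => 0
  arrays := fun A i => if A = 0 then l.getD i 0 else 0

/-- The encoding of a profile: the number `n` of agents, then for each agent `a` the number `k_a`,
the `k_a` agents on its ballot in order, and its backup vote. All entries are at most `n + 1`, so the
length of this list is polynomially related to its size in bits. -/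
def encodeProfile {n : ℕ} (B : Profile n) : List ℕ :=
  n :: (List.finRange n).flatMap fun a =>
    (B a).size :: ((B a).delegates.map Fin.val ++ [((B a).backup : ℕ)])

/-- The program outputs the certificate `c`: cell `a` of array `1` holds the position `c a`. -/
def Memory.HoldsCertificate {n : ℕ} {B : Profile n} (s : Memory) (c : Certificate B) : Prop :=
  ∀ a : Fin n, s.arrays 1 a = c a

end LiquidDemocracy

open LiquidDemocracy

namespace LiquidDemocracy

/-! ### Reachability and tight edges -/

/-! The argument is linear programming duality for arborescences. Raising the dual variable of a set
`L` by `m` raises a lower bound on the cost of every arborescence by `m`, because an arborescence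
has to leave `L`. The bound is attained by any arborescence of tight edges that leaves each set of
the family only once (`FulkersonInv.dual`).

Such an arborescence is grown from the root in the manner of Prim, attaching an earliest tight edge
that enters the tree. Each set of the family was strongly connected by tight edges before any tight
edge left it. A second edge leaving it is therefore never earliest: an older edge inside the set
also enters the tree (`PartialTree.extend`). By complementary slackness the tree is optimal, and
every optimal arborescence consists of tight edges (`PartialTree.subset_tight_of_isMinCost`).

No set of the family contains the root, so edges into the root need not compete for being earliest.
In the delegation graph the growth can thus start with the alternative `1` and postpone `0` until no
agent can be attached. By then the tree contains every vertex that reaches `1` along tight edges,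
and all of these vote `1` (`GreedyTree.add_alt`). So one optimal tree serves all supporters at once,
and the supporters are exactly the agents that reach `1` along tight edges (`mem_supporters_iff`).

The machine program follows the same scheme but lowers weights by one per round. Weights are ballot
positions, so their sum is at most quadratic in the input length, and that many rounds suffice
(`wp_dual`, `wp_tree`). The program is fixed, so a common bound on all its loops yields a polynomial
time bound. -/

theorem Reach.exists_exit {V : Type*} {T : Finset (V × V)} {u v : V} (h : Reach T u v)
    (P : V → Prop) (hu : P u) (hv : ¬ P v) : ∃ e ∈ T, P e.1 ∧ ¬ P e.2 := by
  induction h using Relation.ReflTransGen.head_induction_on with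
  | refl => exact absurd hu hv
  | @head a c hac _ ih =>
    by_cases hc : P c
    · exact ih hc
    · exact ⟨(a, c), hac, hu, hc⟩

theorem Reach.mono {V : Type*} {T T' : Finset (V × V)} (h : T ⊆ T') {u v : V}
    (hr : Reach T u v) : Reach T' u v :=
  Relation.ReflTransGen.mono (fun _ _ hab => h hab) _ _ hr

theorem Reach.edge {V : Type*} {T : Finset (V × V)} {u v w : V} (h : (u, v) ∈ T)
    (hr : Reach T v w) : Reach T u w :=
  Relation.ReflTransGen.head h hr

section Reachable

variable {V : Type*} [Fintype V]

open Classical in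
/-- The set of vertices reachable from `u`. -/
noncomputable def reachable (T : Finset (V × V)) (u : V) : Finset V :=
  Finset.univ.filter fun v => Reach T u v

theorem mem_reachable {T : Finset (V × V)} {u v : V} : v ∈ reachable T u ↔ Reach T u v := by
  simp [reachable]

/-- A smallest reachable set among those avoiding the root is eligible. -/
theorem eligible_of_min [DecidableEq V] {G : WDigraph V} {s : FulkersonState V} {u : V}
    (hu : ¬ Reach s.tight u G.root)
    (hmin : ∀ x, ¬ Reach s.tight x G.root →
      (reachable s.tight u).card ≤ (reachable s.tight x).card) :
    s.Eligible G (reachable s.tight u) := by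
  refine ⟨⟨u, fun v => ?_⟩, by rwa [mem_reachable], ?_⟩
  · rw [mem_reachable]
    refine ⟨fun hv => ⟨hv, ?_⟩, fun hv => hv.1⟩
    -- The vertex `v` does not reach the root either, so minimality makes the two reachable sets
    -- equal. Hence `u` is reachable from `v`.
    have hsub : reachable s.tight v ⊆ reachable s.tight u := by
      intro x hx
      rw [mem_reachable] at hx ⊢
      exact Relation.ReflTransGen.trans hv hx
    have heq := Finset.eq_of_subset_of_card_le hsub
      (hmin v fun h => hu (Relation.ReflTransGen.trans hv h))
    rw [← mem_reachable, heq, mem_reachable]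
    exact Relation.ReflTransGen.refl
  · ext e
    simp only [WDigraph.leaving, Finset.mem_inter, Finset.mem_filter, mem_reachable,
      Finset.notMem_empty, iff_false]
    rintro ⟨⟨_, h1, h2⟩, h3⟩
    exact h2 (Relation.ReflTransGen.tail h1 h3)

/-- In contrapositive form: once the loop condition fails, every vertex reaches the root along tight
edges. -/
theorem exists_eligible [DecidableEq V] {G : WDigraph V} {s : FulkersonState V} {u : V}
    (hu : ¬ Reach s.tight u G.root) : ∃ L, s.Eligible G L := by
  classical
  obtain ⟨v, hv, hmin⟩ := Finset.exists_min_image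
    (Finset.univ.filter fun x => ¬ Reach s.tight x G.root)
    (fun x => (reachable s.tight x).card) ⟨u, by simpa using hu⟩
  exact ⟨_, eligible_of_min (by simpa using hv) fun x hx => hmin x (by simpa using hx)⟩

end Reachable

/-! ### The invariant of Fulkerson's algorithm -/

section Invariant

variable {V : Type*} [DecidableEq V]

/-- The state after raising the dual variable of `L` by `m`. -/
def FulkersonState.raise (G : WDigraph V) (s : FulkersonState V) (L : Finset V) (m : ℕ) :
    FulkersonState V where
  tight := s.tight ∪ (G.leaving L).filter fun e => s.reduce G L m e = 0
  family := insert L s.family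
  weight := s.reduce G L m

/-- The invariant of Fulkerson's algorithm, where `τ` records when an edge became tight. -/
structure FulkersonInv (G : WDigraph V) (s : FulkersonState V) (τ : V × V → ℕ) : Prop where
  tight_subset : s.tight ⊆ G.edges
  weight_tight : ∀ e ∈ s.tight, s.weight e = 0
  tight_of_weight : ∀ e ∈ s.tight, ∀ e' ∈ G.edges, e'.1 = e.1 → s.weight e' = 0 → e' ∈ s.tight
  root_notMem : ∀ L ∈ s.family, G.root ∉ L
  /-- Every proper cut of a member of the family is crossed by an edge that became tight before
  all tight edges leaving that member. -/
  crossing : ∀ L ∈ s.family, ∀ S : Finset V, (∃ x ∈ L, x ∈ S) → (∃ y ∈ L, y ∉ S) →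
    ∃ e ∈ s.tight, e.1 ∈ L ∧ e.1 ∉ S ∧ e.2 ∈ L ∧ e.2 ∈ S ∧
      ∀ e' ∈ s.tight, e'.1 ∈ L → e'.2 ∉ L → τ e < τ e'
  dual : ∃ D, ∀ T, IsArborescence G T → D + ∑ e ∈ T, s.weight e ≤ G.cost T ∧
    ((∀ L ∈ s.family, (T ∩ G.leaving L).card ≤ 1) → D + ∑ e ∈ T, s.weight e = G.cost T)

theorem FulkersonInv.init (G : WDigraph V) (τ : V × V → ℕ) :
    FulkersonInv G (FulkersonState.init G) τ where
  tight_subset := by simp [FulkersonState.init]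
  weight_tight := by simp [FulkersonState.init]
  tight_of_weight := by simp [FulkersonState.init]
  root_notMem := by simp [FulkersonState.init]
  crossing := by simp [FulkersonState.init]
  dual := ⟨0, by simp [FulkersonState.init, WDigraph.cost]⟩

/-- All edges of weight zero may be declared tight at the start. -/
theorem FulkersonInv.zero_edges (G : WDigraph V) (τ : V × V → ℕ) :
    FulkersonInv G ⟨G.edges.filter fun e => G.weight e = 0, ∅, G.weight⟩ τ where
  tight_subset := Finset.filter_subset _ _
  weight_tight := by simp
  tight_of_weight := by
    intro e _ e' he' _ hw
    simpa using ⟨he', hw⟩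
  root_notMem := by simp
  crossing := by simp
  dual := ⟨0, by simp [WDigraph.cost]⟩

theorem FulkersonState.Eligible.mem_of_tight {G : WDigraph V} {s : FulkersonState V}
    {L : Finset V} (hL : s.Eligible G L) (hs : s.tight ⊆ G.edges) {e : V × V}
    (he : e ∈ s.tight) (h1 : e.1 ∈ L) : e.2 ∈ L := by
  by_contra h2
  have : e ∈ G.leaving L ∩ s.tight := by simp [WDigraph.leaving, hs he, h1, h2, he]
  rw [hL.2.2] at this
  simp at this

theorem FulkersonState.Eligible.nonempty {G : WDigraph V} {s : FulkersonState V}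
    {L : Finset V} (hL : s.Eligible G L) : ∃ u, u ∈ L := by
  obtain ⟨u, hu⟩ := hL.1
  exact ⟨u, (hu u).2 ⟨Relation.ReflTransGen.refl, Relation.ReflTransGen.refl⟩⟩

theorem FulkersonState.Eligible.reach {G : WDigraph V} {s : FulkersonState V}
    {L : Finset V} (hL : s.Eligible G L) {x y : V} (hx : x ∈ L) (hy : y ∈ L) :
    Reach s.tight x y := by
  obtain ⟨u, hu⟩ := hL.1
  exact Relation.ReflTransGen.trans ((hu x).1 hx).2 ((hu y).1 hy).1

theorem IsArborescence.exists_leaving {G : WDigraph V} {T : Finset (V × V)}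
    (hT : IsArborescence G T) {L : Finset V} {u : V} (hu : u ∈ L) (hr : G.root ∉ L) :
    ∃ e, e ∈ T ∩ G.leaving L := by
  obtain ⟨e, he, h1, h2⟩ := (hT.reach_root u).exists_exit (· ∈ L) hu hr
  exact ⟨e, by simp [WDigraph.leaving, he, hT.subset he, h1, h2]⟩

/-- Each edge of `T` that leaves `L` loses exactly `m`; the bound `hm` keeps the truncated
subtraction exact. -/
theorem FulkersonState.sum_reduce (G : WDigraph V) (s : FulkersonState V) (L : Finset V) (m : ℕ)
    (hm : ∀ e ∈ G.leaving L, m ≤ s.weight e) (T : Finset (V × V)) :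
    ∑ e ∈ T, s.weight e = ∑ e ∈ T, s.reduce G L m e + (T ∩ G.leaving L).card * m := by
  have h : ∀ e ∈ T, s.weight e = s.reduce G L m e + if e ∈ G.leaving L then m else 0 := by
    intro e _
    unfold FulkersonState.reduce
    split_ifs with h
    · have := hm e h
      omega
    · rfl
  rw [Finset.sum_congr rfl h, Finset.sum_add_distrib, ← Finset.sum_filter, Finset.sum_const,
    smul_eq_mul, Finset.filter_mem_eq_inter]

/-- Only `m ≤ s.weight e` on the cut is required, not that `m` is the minimum. The lemma therefore
covers both Fulkerson's iterations and the unit decrements of the program. The new times must keep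
the old ones and place newly tight edges after them. -/
theorem FulkersonInv.raise {G : WDigraph V} {s : FulkersonState V} {τ τ' : V × V → ℕ}
    (h : FulkersonInv G s τ) (hloop : ∀ u, (u, u) ∉ G.edges) {L : Finset V} {m : ℕ}
    (hL : s.Eligible G L) (hm : ∀ e ∈ G.leaving L, m ≤ s.weight e)
    (hold : ∀ e ∈ s.tight, τ' e = τ e)
    (hnew : ∀ e ∈ s.tight, ∀ e' ∈ (s.raise G L m).tight, e' ∉ s.tight → τ e < τ' e') :
    FulkersonInv G (s.raise G L m) τ' where
  tight_subset := by
    refine Finset.union_subset h.tight_subset ?_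
    exact (Finset.filter_subset _ _).trans (Finset.filter_subset _ _)
  weight_tight := by
    intro e he
    simp only [FulkersonState.raise, Finset.mem_union, Finset.mem_filter] at he ⊢
    rcases he with he | he
    · have := h.weight_tight e he
      unfold FulkersonState.reduce
      split_ifs <;> omega
    · exact he.2
  tight_of_weight := by
    intro e he e' he' hee hw
    simp only [FulkersonState.raise, Finset.mem_union, Finset.mem_filter] at he hw ⊢
    by_cases hl : e' ∈ G.leaving L
    · exact Or.inr ⟨hl, hw⟩
    left
    have hw' : s.weight e' = 0 := by simpa [FulkersonState.reduce, hl] using hw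
    -- The remaining case is a source without an older tight edge whose zero-weight edge `e'` stays
    -- inside `L`. As there are no loops, `L` then has a second vertex, and strong connectivity
    -- gives the source a tight edge after all.
    by_cases hex : ∃ e'' ∈ s.tight, e''.1 = e'.1
    · obtain ⟨e'', h1, h2⟩ := hex
      exact h.tight_of_weight e'' h1 e' he' h2.symm hw'
    exfalso
    rcases he with he | ⟨he, _⟩
    · exact hex ⟨e, he, hee.symm⟩
    have h1 : e'.1 ∈ L := by
      rw [hee]
      simp only [WDigraph.leaving, Finset.mem_filter] at he
      exact he.2.1
    have h2 : e'.2 ∈ L := by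
      by_contra h2
      exact hl (by simp [WDigraph.leaving, he', h1, h2])
    rcases Relation.ReflTransGen.cases_head (hL.reach h1 h2) with heq | ⟨c, hc, _⟩
    · apply hloop e'.1
      have : e' = (e'.1, e'.1) := Prod.ext rfl heq.symm
      rwa [← this]
    · exact hex ⟨_, hc, rfl⟩
  root_notMem := by
    intro L' hL'
    simp only [FulkersonState.raise, Finset.mem_insert] at hL'
    rcases hL' with rfl | hL'
    · exact hL.2.1
    · exact h.root_notMem L' hL'
  crossing := by
    intro L' hL' S hx hy
    simp only [FulkersonState.raise, Finset.mem_insert] at hL'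
    -- A set may be raised repeatedly. If it is already in the family, its old crossing edge still
    -- works, since edges that become tight now are later still.
    by_cases hmem : L' ∈ s.family
    · obtain ⟨e, he, h1, h2, h3, h4, h5⟩ := h.crossing L' hmem S hx hy
      refine ⟨e, Finset.mem_union_left _ he, h1, h2, h3, h4, fun e' he' h6 h7 => ?_⟩
      rw [hold e he]
      by_cases het : e' ∈ s.tight
      · rw [hold e' het]
        exact h5 e' het h6 h7
      · exact hnew e he e' he' het
    · obtain rfl : L' = L := by tauto
      obtain ⟨x, hxL, hxS⟩ := hx
      obtain ⟨y, hyL, hyS⟩ := hy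
      -- A tight path from `y` to `x` must leave `L' \ S`. No old tight edge leaves `L'`, so it does
      -- so by entering `L' ∩ S`.
      obtain ⟨e, he, ⟨h1, h2⟩, h3⟩ := (hL.reach hyL hxL).exists_exit (fun v => v ∈ L' ∧ v ∉ S)
        ⟨hyL, hyS⟩ (fun hx => hx.2 hxS)
      have h4 := hL.mem_of_tight h.tight_subset he h1
      refine ⟨e, Finset.mem_union_left _ he, h1, h2, h4, by tauto, fun e' he' h6 h7 => ?_⟩
      have het : e' ∉ s.tight := fun het => h7 (hL.mem_of_tight h.tight_subset het h6)
      rw [hold e he]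
      exact hnew e he e' he' het
  dual := by
    obtain ⟨D, hD⟩ := h.dual
    refine ⟨D + m, fun T hT => ?_⟩
    obtain ⟨h1, h2⟩ := hD T hT
    rw [FulkersonState.sum_reduce G s L m hm T] at h1 h2
    obtain ⟨u, hu⟩ := hL.nonempty
    have hcard : 1 ≤ (T ∩ G.leaving L).card :=
      Finset.card_pos.2 (hT.exists_leaving hu hL.2.1)
    change D + m + ∑ e ∈ T, s.reduce G L m e ≤ _ ∧ (_ → D + m + ∑ e ∈ T, s.reduce G L m e = _)
    constructor
    · nlinarith
    · intro hF
      have h3 := h2 fun L' hL' => hF L' (Finset.mem_insert_of_mem hL')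
      have h4 : (T ∩ G.leaving L).card = 1 :=
        le_antisymm (hF L (Finset.mem_insert_self _ _)) hcard
      rw [h4] at h3
      omega

theorem FulkersonInv.of_steps {G : WDigraph V} (hloop : ∀ u, (u, u) ∉ G.edges)
    {s : FulkersonState V}
    (h : Relation.ReflTransGen (FulkersonStep G) (FulkersonState.init G) s) :
    ∃ τ, FulkersonInv G s τ := by
  induction h with
  | refl => exact ⟨0, FulkersonInv.init G 0⟩
  | @tail b c _ hstep ih =>
    obtain ⟨τ, hτ⟩ := ih
    obtain ⟨L, m, hL, hm⟩ := hstep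
    -- One plus the sum of all earlier times exceeds each of them.
    refine ⟨fun e => if e ∈ b.tight then τ e else ∑ e ∈ b.tight, τ e + 1,
      hτ.raise hloop hL (fun e he => hm.2 ⟨e, he, rfl⟩) (fun e he => by simp [he]) ?_⟩
    intro e he e' _ hne
    have := Finset.single_le_sum (f := τ) (fun _ _ => Nat.zero_le _) he
    simp only [hne, if_false]
    omega

/-- If every vertex reaches the root, Fulkerson's algorithm can be run to completion. -/
theorem exists_fulkersonOutput (G : WDigraph V) (hreach : ∀ u, Reach G.edges u G.root) :
    ∃ E' F, IsFulkersonOutput G E' F := by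
  -- Induction on the number of edges that are not yet tight. The edge attaining the minimum becomes
  -- tight, and it was not tight before because no tight edge leaves an eligible set.
  suffices H : ∀ k, ∀ s : FulkersonState V, s.tight ⊆ G.edges →
      G.edges.card - s.tight.card ≤ k →
      Relation.ReflTransGen (FulkersonStep G) (FulkersonState.init G) s →
      ∃ E' F, IsFulkersonOutput G E' F from
    H _ _ (by simp [FulkersonState.init]) le_rfl Relation.ReflTransGen.refl
  intro k
  induction k with
  | zero =>
    intro s hs hk hrun
    by_cases hE : ∃ L, s.Eligible G L
    · exfalso
      obtain ⟨L, hL⟩ := hE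
      obtain ⟨u, hu⟩ := hL.nonempty
      obtain ⟨e, he, h1, h2⟩ := (hreach u).exists_exit (· ∈ L) hu hL.2.1
      have := Finset.eq_of_subset_of_card_le hs (by omega)
      exact h2 (hL.mem_of_tight hs (this ▸ he) h1)
    · exact ⟨_, _, s, hrun, hE, rfl, rfl⟩
  | succ k ih =>
    intro s hs hk hrun
    by_cases hE : ∃ L, s.Eligible G L
    · obtain ⟨L, hL⟩ := hE
      obtain ⟨u, hu⟩ := hL.nonempty
      obtain ⟨e, he, h1, h2⟩ := (hreach u).exists_exit (· ∈ L) hu hL.2.1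
      have hel : e ∈ G.leaving L := by simp [WDigraph.leaving, he, h1, h2]
      obtain ⟨f, hf, hfmin⟩ := Finset.exists_min_image (G.leaving L) s.weight ⟨e, hel⟩
      have hstep : FulkersonStep G s (s.raise G L (s.weight f)) :=
        FulkersonStep.iter s L (s.weight f) hL
          ⟨⟨f, hf, rfl⟩, by rintro x ⟨e', he', rfl⟩; exact hfmin e' he'⟩
      have hsub : (s.raise G L (s.weight f)).tight ⊆ G.edges :=
        Finset.union_subset hs ((Finset.filter_subset _ _).trans (Finset.filter_subset _ _))
      refine ih _ hsub ?_ (hrun.tail hstep)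
      have hft : f ∉ s.tight := by
        intro hft
        have h3 := hf
        simp only [WDigraph.leaving, Finset.mem_filter] at h3
        exact h3.2.2 (hL.mem_of_tight hs hft h3.2.1)
      have hft' : f ∈ (s.raise G L (s.weight f)).tight := by
        refine Finset.mem_union_right _ (Finset.mem_filter.2 ⟨hf, ?_⟩)
        simp [FulkersonState.reduce, hf]
      have hlt : s.tight.card < (s.raise G L (s.weight f)).tight.card :=
        Finset.card_lt_card ⟨Finset.subset_union_left, fun hh => hft (hh hft')⟩
      omega
    · exact ⟨_, _, s, hrun, hE, rfl, rfl⟩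

/-! ### Growing a tree along earliest tight edges -/

/-- `T` is a tree of tight edges on the vertex set `S`, oriented towards the root, that has at most
one edge leaving each member of the family. -/
structure PartialTree (G : WDigraph V) (s : FulkersonState V) (S : Finset V)
    (T : Finset (V × V)) : Prop where
  root_mem : G.root ∈ S
  subset_tight : T ⊆ s.tight
  source_mem : ∀ e ∈ T, e.1 ∈ S ∧ e.1 ≠ G.root
  unique_out : ∀ u ∈ S, u ≠ G.root → ∃! v, (u, v) ∈ T
  reach_root : ∀ u ∈ S, Reach T u G.root
  card_leaving : ∀ L ∈ s.family, (T ∩ G.leaving L).card ≤ 1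

theorem PartialTree.root (G : WDigraph V) (s : FulkersonState V) :
    PartialTree G s {G.root} ∅ where
  root_mem := by simp
  subset_tight := by simp
  source_mem := by simp
  unique_out := by
    intro u hu hr
    exact absurd (Finset.mem_singleton.1 hu) hr
  reach_root := by
    intro u hu
    rw [Finset.mem_singleton.1 hu]
    exact Relation.ReflTransGen.refl
  card_leaving := by simp

/-- Suppose the tree already leaves `L` and the new edge leaves `L` as well. Then `S` meets `L`
without containing it, and the crossing edge inside `L` enters `S` earlier than `(u, v)`, against
minimality. Competitors ending at the root can be ignored because the crossing edge ends in `L`,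
which avoids the root. -/
theorem PartialTree.extend {G : WDigraph V} {s : FulkersonState V} {τ : V × V → ℕ}
    {S : Finset V} {T : Finset (V × V)} (hT : PartialTree G s S T) (h : FulkersonInv G s τ)
    {u v : V} (he : (u, v) ∈ s.tight) (h1 : u ∉ S) (h2 : v ∈ S)
    (hmin : ∀ e' ∈ s.tight, e'.1 ∉ S → e'.2 ∈ S → e'.2 ≠ G.root → τ (u, v) ≤ τ e') :
    PartialTree G s (insert u S) (insert (u, v) T) where
  root_mem := Finset.mem_insert_of_mem hT.root_mem
  subset_tight := Finset.insert_subset he hT.subset_tight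
  source_mem := by
    intro e' he'
    rcases Finset.mem_insert.1 he' with rfl | he'
    · exact ⟨Finset.mem_insert_self _ _, fun h3 => h1 ((show u = G.root from h3) ▸ hT.root_mem)⟩
    · exact ⟨Finset.mem_insert_of_mem (hT.source_mem _ he').1, (hT.source_mem _ he').2⟩
  unique_out := by
    intro x hx hr
    rcases Finset.mem_insert.1 hx with rfl | hx
    · refine ⟨v, Finset.mem_insert_self _ _, fun w hw => ?_⟩
      rcases Finset.mem_insert.1 hw with hw | hw
      · exact (Prod.mk.inj hw).2
      · exact absurd (hT.source_mem _ hw).1 h1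
    · obtain ⟨w, hw, huniq⟩ := hT.unique_out x hx hr
      refine ⟨w, Finset.mem_insert_of_mem hw, fun w' hw' => ?_⟩
      rcases Finset.mem_insert.1 hw' with hw' | hw'
      · exact absurd ((Prod.mk.inj hw').1 ▸ hx) h1
      · exact huniq w' hw'
  reach_root := by
    intro x hx
    have hsub : T ⊆ insert (u, v) T := Finset.subset_insert _ _
    rcases Finset.mem_insert.1 hx with rfl | hx
    · exact Reach.edge (Finset.mem_insert_self _ _) ((hT.reach_root v h2).mono hsub)
    · exact (hT.reach_root x hx).mono hsub
  card_leaving := by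
    intro L hL
    by_cases hl : (u, v) ∈ G.leaving L
    · have hu : u ∈ L := (Finset.mem_filter.1 hl).2.1
      have hv : v ∉ L := (Finset.mem_filter.1 hl).2.2
      have hempty : T ∩ G.leaving L = ∅ := by
        by_contra hne
        obtain ⟨e', he'⟩ := Finset.nonempty_iff_ne_empty.2 hne
        rw [Finset.mem_inter] at he'
        obtain ⟨f, hf, h3, h4, h5, h6, h7⟩ := h.crossing L hL S
          ⟨e'.1, (Finset.mem_filter.1 he'.2).2.1, (hT.source_mem _ he'.1).1⟩ ⟨u, hu, h1⟩
        have h8 := h7 _ he hu hv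
        have h9 := hmin f hf h4 h6 fun hr => h.root_notMem L hL (hr ▸ h5)
        omega
      rw [Finset.insert_inter_of_mem hl, hempty]
      simp
    · rw [Finset.insert_inter_of_notMem hl]
      exact hT.card_leaving L hL

theorem PartialTree.isArborescence {G : WDigraph V} {s : FulkersonState V} {τ : V × V → ℕ}
    {S : Finset V} {T : Finset (V × V)} (hT : PartialTree G s S T) (h : FulkersonInv G s τ)
    (hS : ∀ u, u ∈ S) : IsArborescence G T where
  subset := hT.subset_tight.trans h.tight_subset
  root_no_out := fun _ hv => (hT.source_mem _ hv).2 rfl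
  unique_out := fun u hu => hT.unique_out u (hS u) hu
  reach_root := fun u => hT.reach_root u (hS u)

/-- Complementary slackness: a spanning tree grown in this way has minimum cost, and all
arborescences of minimum cost consist of edges of reduced weight `0`. -/
theorem PartialTree.cost_eq {G : WDigraph V} {s : FulkersonState V} {τ : V × V → ℕ}
    {S : Finset V} {T : Finset (V × V)} (hT : PartialTree G s S T) (h : FulkersonInv G s τ)
    (hS : ∀ u, u ∈ S) {T' : Finset (V × V)} (hT' : IsArborescence G T') :
    G.cost T + ∑ e ∈ T', s.weight e ≤ G.cost T' := by
  obtain ⟨D, hD⟩ := h.dual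
  have h1 := (hD T (hT.isArborescence h hS)).2 hT.card_leaving
  have h2 := (hD T' hT').1
  -- The tree has reduced weight zero, so its cost equals the dual value `D`.
  rw [Finset.sum_eq_zero fun e he => h.weight_tight e (hT.subset_tight he)] at h1
  omega

theorem PartialTree.isMinCost {G : WDigraph V} {s : FulkersonState V} {τ : V × V → ℕ}
    {S : Finset V} {T : Finset (V × V)} (hT : PartialTree G s S T) (h : FulkersonInv G s τ)
    (hS : ∀ u, u ∈ S) : IsMinCostArborescence G T :=
  ⟨hT.isArborescence h hS, fun T' hT' => by have := hT.cost_eq h hS hT'; omega⟩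

/-- Slackness only gives reduced weight zero, and an edge of weight zero need not be tight in
general. Here its source already has a tight edge, namely the one in `T`, and `tight_of_weight`
applies. -/
theorem PartialTree.subset_tight_of_isMinCost {G : WDigraph V} {s : FulkersonState V}
    {τ : V × V → ℕ} {S : Finset V} {T : Finset (V × V)} (hT : PartialTree G s S T)
    (h : FulkersonInv G s τ) (hS : ∀ u, u ∈ S) {T' : Finset (V × V)}
    (hT' : IsMinCostArborescence G T') : T' ⊆ s.tight := by
  intro e he
  have h1 := hT.cost_eq h hS hT'.1
  have h2 := hT'.2 T (hT.isArborescence h hS)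
  have h3 : s.weight e = 0 := by
    have := Finset.single_le_sum (f := s.weight) (fun _ _ => Nat.zero_le _) he
    omega
  have hr : e.1 ≠ G.root := by
    intro hr
    apply hT'.1.root_no_out e.2
    rwa [← hr]
  obtain ⟨v, hv, _⟩ := hT.unique_out e.1 (hS _) hr
  exact h.tight_of_weight _ (hT.subset_tight hv) e (hT'.1.subset he) rfl h3

end Invariant

end LiquidDemocracy

namespace LiquidDemocracy

/-! ### The delegation graph -/

/-- The numbering of the vertices: first the agents, then the alternatives, then the root. -/
def Vertex.code {n : ℕ} : Vertex n → ℕ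
  | .agent a => a
  | .alt d => n + d
  | .root => n + 2

theorem Vertex.code_lt {n : ℕ} (v : Vertex n) : v.code < n + 3 := by
  cases v <;> simp only [Vertex.code] <;> omega

theorem Vertex.code_injective {n : ℕ} : Function.Injective (Vertex.code (n := n)) := by
  intro u v h
  cases u <;> cases v <;> simp only [Vertex.code] at h <;> first | rfl | (congr 1; omega)

noncomputable instance {n : ℕ} : Fintype (Vertex n) :=
  Fintype.ofInjective (fun v : Vertex n => (⟨v.code, v.code_lt⟩ : Fin (n + 3)))
    fun _ _ h => Vertex.code_injective (congrArg Fin.val h)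

theorem Vertex.card_le (n : ℕ) : Fintype.card (Vertex n) ≤ n + 3 := by
  have := Fintype.card_le_of_injective
    (fun v : Vertex n => (⟨v.code, v.code_lt⟩ : Fin (n + 3)))
    fun _ _ h => Vertex.code_injective (congrArg Fin.val h)
  simpa using this

variable {n : ℕ} {B : Profile n}

theorem mem_delegationGraph {u v : Vertex n} : (u, v) ∈ (delegationGraph B).edges ↔
    ((∃ d, u = .alt d) ∧ v = .root) ∨ ∃ a i, u = .agent a ∧ v = (B a).entry i := by
  simp only [delegationGraph, Finset.mem_union, Finset.mem_image, Finset.mem_univ, true_and,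
    Finset.mem_biUnion, Prod.mk.injEq]
  constructor
  · rintro (⟨d, rfl, rfl⟩ | ⟨a, i, rfl, rfl⟩)
    · exact Or.inl ⟨⟨d, rfl⟩, rfl⟩
    · exact Or.inr ⟨a, i, rfl, rfl⟩
  · rintro (⟨⟨d, rfl⟩, rfl⟩ | ⟨a, i, rfl, rfl⟩)
    · exact Or.inl ⟨d, rfl, rfl⟩
    · exact Or.inr ⟨a, i, rfl, rfl⟩

theorem Ballot.entry_ne_root {a : Fin n} (b : Ballot n a) (i) : b.entry i ≠ .root := by
  unfold Ballot.entry
  split_ifs <;> simp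

theorem Ballot.entry_ne_self {a : Fin n} (b : Ballot n a) (i) : b.entry i ≠ .agent a := by
  unfold Ballot.entry
  split_ifs with h
  · intro heq
    have hmem := List.getElem_mem h
    rw [Vertex.agent.inj heq] at hmem
    exact b.notMem hmem
  · simp

theorem delegationGraph_no_loop (u : Vertex n) : (u, u) ∉ (delegationGraph B).edges := by
  rw [mem_delegationGraph]
  rintro (⟨⟨d, rfl⟩, h⟩ | ⟨a, i, rfl, h⟩)
  · simp at h
  · exact (B a).entry_ne_self i h.symm

theorem delegationGraph_target_alt {d : Fin 2} {v : Vertex n}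
    (h : (.alt d, v) ∈ (delegationGraph B).edges) : v = .root := by
  rw [mem_delegationGraph] at h
  rcases h with ⟨_, h⟩ | ⟨_, _, h, _⟩
  · exact h
  · simp at h

theorem delegationGraph_no_out_root (v : Vertex n) : (.root, v) ∉ (delegationGraph B).edges := by
  rw [mem_delegationGraph]
  simp

theorem delegationGraph_source_of_root {u : Vertex n}
    (h : (u, .root) ∈ (delegationGraph B).edges) : ∃ d, u = .alt d := by
  rw [mem_delegationGraph] at h
  rcases h with ⟨h, _⟩ | ⟨a, i, _, h⟩
  · exact h
  · exact absurd h.symm ((B a).entry_ne_root i)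

theorem alt_root_mem (B : Profile n) (d : Fin 2) :
    (Vertex.alt d, Vertex.root) ∈ (delegationGraph B).edges :=
  mem_delegationGraph.2 (Or.inl ⟨⟨d, rfl⟩, rfl⟩)

theorem agent_entry_mem (B : Profile n) (a : Fin n) (i : Fin ((B a).size + 1)) :
    (Vertex.agent a, (B a).entry i) ∈ (delegationGraph B).edges :=
  mem_delegationGraph.2 (Or.inr ⟨a, i, rfl, rfl⟩)

theorem delegationGraph_reach_root (u : Vertex n) : Reach (delegationGraph B).edges u .root := by
  have halt : ∀ d, Reach (delegationGraph B).edges (.alt d) .root := fun d =>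
    Relation.ReflTransGen.single (alt_root_mem B d)
  cases u with
  | root => exact Relation.ReflTransGen.refl
  | alt d => exact halt d
  | agent a =>
    have h := agent_entry_mem B a (Fin.last _)
    have he : (B a).entry (Fin.last _) = .alt (B a).backup := by
      simp [Ballot.entry, Ballot.size]
    rw [he] at h
    exact Reach.edge h (halt _)

/-- A tree grown from the alternative `1`, to which the alternative `0` is added only when no
further agent can be attached. -/
structure GreedyTree (B : Profile n) (s : FulkersonState (Vertex n)) (S : Finset (Vertex n))
    (T : Finset (Vertex n × Vertex n)) : Prop extends PartialTree (delegationGraph B) s S T where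
  alt_one_mem : .alt 1 ∈ S
  reach_of_notMem : .alt 0 ∉ S → ∀ u ∈ S, u ≠ .root → Reach T u (.alt 1)
  reach_of_mem : .alt 0 ∈ S → ∀ u, Reach s.tight u (.alt 1) → Reach T u (.alt 1)

variable {s : FulkersonState (Vertex n)} {τ : Vertex n × Vertex n → ℕ}
  {S : Finset (Vertex n)} {T : Finset (Vertex n × Vertex n)}

theorem alt_root_tight (h : FulkersonInv (delegationGraph B) s τ)
    (hreach : ∀ u, Reach s.tight u .root) (d : Fin 2) : (.alt d, .root) ∈ s.tight := by
  rcases Relation.ReflTransGen.cases_head (hreach (.alt d)) with heq | ⟨v, hv, _⟩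
  · simp at heq
  · rwa [← delegationGraph_target_alt (h.tight_subset hv)]

theorem GreedyTree.start (h : FulkersonInv (delegationGraph B) s τ)
    (hreach : ∀ u, Reach s.tight u .root) :
    GreedyTree B s {.alt 1, .root} {(.alt 1, .root)} where
  toPartialTree := by
    refine (PartialTree.root (delegationGraph B) s).extend h (alt_root_tight h hreach 1)
      (by simp [delegationGraph]) (by simp [delegationGraph]) ?_
    intro e' _ _ h2 h3
    exact absurd (Finset.mem_singleton.1 h2) h3
  alt_one_mem := by simp
  reach_of_notMem := by
    intro _ u hu hr
    simp only [Finset.mem_insert, Finset.mem_singleton, hr, or_false] at hu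
    rw [hu]
    exact Relation.ReflTransGen.refl
  reach_of_mem := by simp

theorem GreedyTree.add_agent (hT : GreedyTree B s S T) (h : FulkersonInv (delegationGraph B) s τ)
    {u v : Vertex n} (he : (u, v) ∈ s.tight) (h1 : u ∉ S) (h2 : v ∈ S) (h3 : v ≠ .root)
    (hmin : ∀ e' ∈ s.tight, e'.1 ∉ S → e'.2 ∈ S → e'.2 ≠ .root → τ (u, v) ≤ τ e') :
    GreedyTree B s (insert u S) (insert (u, v) T) where
  toPartialTree := hT.toPartialTree.extend h he h1 h2 hmin
  alt_one_mem := Finset.mem_insert_of_mem hT.alt_one_mem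
  reach_of_notMem := by
    intro h0 x hx hr
    have h0' : .alt 0 ∉ S := fun hh => h0 (Finset.mem_insert_of_mem hh)
    have hsub : T ⊆ insert (u, v) T := Finset.subset_insert _ _
    rcases Finset.mem_insert.1 hx with rfl | hx
    · exact Reach.edge (Finset.mem_insert_self _ _) ((hT.reach_of_notMem h0' v h2 h3).mono hsub)
    · exact (hT.reach_of_notMem h0' x hx hr).mono hsub
  reach_of_mem := by
    intro h0 x hx
    have h0' : .alt 0 ∈ S := by
      rcases Finset.mem_insert.1 h0 with rfl | h0
      · exact absurd (delegationGraph_target_alt (h.tight_subset he)) h3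
      · exact h0
    exact (hT.reach_of_mem h0' x hx).mono (Finset.subset_insert _ _)

/-- This is where `1` is favoured: when no agent can be attached, the tree without `0` already holds
every vertex with a tight path to `1`. The edge from `0` to the root has no competitor, whatever its
time. -/
theorem GreedyTree.add_alt (hT : GreedyTree B s S T) (h : FulkersonInv (delegationGraph B) s τ)
    (hreach : ∀ u, Reach s.tight u .root) (h0 : .alt 0 ∉ S)
    (hstuck : ∀ e' ∈ s.tight, e'.1 ∉ S → e'.2 ∈ S → e'.2 = .root) :
    GreedyTree B s (insert (.alt 0) S) (insert (.alt 0, .root) T) where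
  toPartialTree := hT.toPartialTree.extend h (alt_root_tight h hreach 0) h0 hT.root_mem
    fun e' h1 h2 h3 h4 => absurd (hstuck e' h1 h2 h3) h4
  alt_one_mem := Finset.mem_insert_of_mem hT.alt_one_mem
  reach_of_notMem := fun hh => absurd (Finset.mem_insert_self _ _) hh
  reach_of_mem := by
    intro _ x hx
    have hx' : x ∈ S ∧ x ≠ .root := by
      by_contra hnot
      -- A path to `1` from elsewhere would enter the non-root part of the tree by a tight edge. Its
      -- source is not the root, which has no outgoing edges, so it contradicts being stuck.
      obtain ⟨e, he, h1, h2⟩ := hx.exists_exit (fun v => ¬ (v ∈ S ∧ v ≠ .root)) hnot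
        (by simp [hT.alt_one_mem])
      rw [not_not] at h2
      have h3 : e.1 ≠ .root := by
        intro h3
        exact delegationGraph_no_out_root e.2 (B := B) (h3 ▸ h.tight_subset he)
      exact h2.2 (hstuck e he (fun h4 => h1 ⟨h4, h3⟩) h2.1)
    exact (hT.reach_of_notMem h0 x hx'.1 hx'.2).mono (Finset.subset_insert _ _)

/-- When the alternative `0` is in the tree and no agent can be attached, the tree is spanning. -/
theorem GreedyTree.spanning (hT : GreedyTree B s S T) (h : FulkersonInv (delegationGraph B) s τ)
    (hreach : ∀ u, Reach s.tight u .root) (h0 : .alt 0 ∈ S)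
    (hstuck : ∀ e' ∈ s.tight, e'.1 ∉ S → e'.2 ∈ S → e'.2 = .root) (u : Vertex n) : u ∈ S := by
  by_contra hu
  obtain ⟨e, he, h1, h2⟩ := (hreach u).exists_exit (fun v => v ∉ S) hu
    (not_not.2 hT.root_mem)
  rw [not_not] at h2
  -- The entering edge ends at the root, hence starts at an alternative, but both alternatives are
  -- in `S`.
  have hr := hstuck e he h1 h2
  obtain ⟨d, hd⟩ := delegationGraph_source_of_root (u := e.1) (B := B) (hr ▸ h.tight_subset he)
  rw [hd] at h1
  fin_cases d
  · exact h1 h0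
  · exact h1 hT.alt_one_mem

theorem GreedyTree.exists_spanning (h : FulkersonInv (delegationGraph B) s τ)
    (hreach : ∀ u, Reach s.tight u .root) : ∃ T, GreedyTree B s Finset.univ T := by
  suffices H : ∀ k, ∀ S T, GreedyTree B s S T → Sᶜ.card ≤ k →
      ∃ T, GreedyTree B s Finset.univ T from H _ _ _ (GreedyTree.start h hreach) le_rfl
  intro k
  induction k with
  | zero =>
    intro S T hT hk
    have : S = Finset.univ := by simpa using hk
    exact ⟨T, this ▸ hT⟩
  | succ k ih =>
    intro S T hT hk
    have hcard : ∀ u ∉ S, (insert u S)ᶜ.card ≤ k := by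
      intro u hu
      have : (insert u S)ᶜ.card < Sᶜ.card := by
        apply Finset.card_lt_card
        rw [Finset.compl_ssubset_compl]
        exact Finset.ssubset_insert hu
      omega
    by_cases hstuck : ∀ e' ∈ s.tight, e'.1 ∉ S → e'.2 ∈ S → e'.2 = .root
    · by_cases h0 : .alt 0 ∈ S
      · have : S = Finset.univ := Finset.eq_univ_iff_forall.2 (hT.spanning h hreach h0 hstuck)
        exact ⟨T, this ▸ hT⟩
      · exact ih _ _ (hT.add_alt h hreach h0 hstuck) (hcard _ h0)
    · push Not at hstuck
      obtain ⟨e, h1, h2, h3, h4⟩ := hstuck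
      obtain ⟨f, hf, hmin⟩ := Finset.exists_min_image
        (s.tight.filter fun e' => e'.1 ∉ S ∧ e'.2 ∈ S ∧ e'.2 ≠ .root) τ
        ⟨e, Finset.mem_filter.2 ⟨h1, h2, h3, h4⟩⟩
      obtain ⟨h5, h6, h7, h8⟩ := Finset.mem_filter.1 hf
      exact ih _ _ (hT.add_agent h h5 h6 h7 h8 fun e' g1 g2 g3 g4 =>
        hmin e' (Finset.mem_filter.2 ⟨g1, g2, g3, g4⟩)) (hcard _ h6)

/-- Optimal arborescences are tight, which gives one direction. The single tree of
`GreedyTree.exists_spanning` witnesses all agents in the other. -/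
theorem mem_supporters_iff (h : FulkersonInv (delegationGraph B) s τ)
    (hreach : ∀ u, Reach s.tight u .root) (a : Fin n) :
    a ∈ supporters B ↔ Reach s.tight (.agent a) (.alt 1) := by
  obtain ⟨T, hT⟩ := GreedyTree.exists_spanning h hreach
  constructor
  · rintro ⟨T', hT', hv⟩
    exact Reach.mono (hT.toPartialTree.subset_tight_of_isMinCost h (by simp) hT') hv
  · intro ha
    exact ⟨T, hT.toPartialTree.isMinCost h (by simp), hT.reach_of_mem (by simp) _ ha⟩

theorem mem_supporters_iff_of_output {E' : Finset (Vertex n × Vertex n)}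
    {F : Finset (Finset (Vertex n))} (hout : IsFulkersonOutput (delegationGraph B) E' F)
    (a : Fin n) : a ∈ supporters B ↔ Reach E' (.agent a) (.alt 1) := by
  obtain ⟨s, hrun, hdone, rfl, rfl⟩ := hout
  obtain ⟨τ, h⟩ := FulkersonInv.of_steps delegationGraph_no_loop hrun
  refine mem_supporters_iff h (fun u => ?_) a
  by_contra hu
  exact hdone (exists_eligible hu)

end LiquidDemocracy

namespace LiquidDemocracy

/-! ### Verifying programs -/

/-- A bound on the running time of a program all of whose loops are iterated at most `X` times. -/
noncomputable def Program.timeBound : Program → Polynomial ℕ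
  | .skip => 1
  | .setReg _ e => (e.steps + 1 : ℕ)
  | .setCell _ i e => (i.steps + e.steps + 1 : ℕ)
  | .seq p q => p.timeBound + q.timeBound
  | .cond b p q => ((b.steps + 1 : ℕ) : Polynomial ℕ) + (p.timeBound + q.timeBound)
  | .loop b p =>
    Polynomial.X * (((b.steps + 1 : ℕ) : Polynomial ℕ) + p.timeBound) +
      ((b.steps + 1 : ℕ) : Polynomial ℕ)

/-- Started in memory `s`, the program `p` halts in a memory satisfying `Q`, within the time bound
for loops of at most `M` iterations. -/
def WP (M : ℕ) (p : Program) (s : Memory) (Q : Memory → Prop) : Prop :=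
  ∃ t s', Runs p s t s' ∧ t ≤ p.timeBound.eval M ∧ Q s'

variable {M : ℕ} {s : Memory} {Q Q' : Memory → Prop}

theorem WP.mono {p : Program} (h : WP M p s Q) (hQ : ∀ s', Q s' → Q' s') : WP M p s Q' := by
  obtain ⟨t, s', h1, h2, h3⟩ := h
  exact ⟨t, s', h1, h2, hQ s' h3⟩

theorem WP.skip (h : Q s) : WP M .skip s Q :=
  ⟨1, s, .skip s, by simp [Program.timeBound], h⟩

theorem WP.setReg {x : ℕ} {e : RExpr} (h : Q (s.setReg x (e.eval s))) :
    WP M (.setReg x e) s Q :=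
  ⟨_, _, .setReg s x e, by simp [Program.timeBound], h⟩

theorem WP.setCell {A : ℕ} {i e : RExpr} (h : Q (s.setCell A (i.eval s) (e.eval s))) :
    WP M (.setCell A i e) s Q :=
  ⟨_, _, .setCell s A i e, by simp [Program.timeBound], h⟩

theorem WP.seq {p q : Program} (h : WP M p s fun s' => WP M q s' Q) : WP M (.seq p q) s Q := by
  obtain ⟨t, s', h1, h2, t', s'', h3, h4, h5⟩ := h
  refine ⟨t + t', s'', .seq h1 h3, ?_, h5⟩
  simp only [Program.timeBound, Polynomial.eval_add]
  omega

theorem WP.cond {b : RExpr} {p q : Program} (hp : b.eval s ≠ 0 → WP M p s Q)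
    (hq : b.eval s = 0 → WP M q s Q) : WP M (.cond b p q) s Q := by
  by_cases hb : b.eval s = 0
  · obtain ⟨t, s', h1, h2, h3⟩ := hq hb
    refine ⟨_, s', .cond_false hb h1, ?_, h3⟩
    simp only [Program.timeBound, Polynomial.eval_add, Polynomial.eval_natCast, Nat.cast_id]
    omega
  · obtain ⟨t, s', h1, h2, h3⟩ := hp hb
    refine ⟨_, s', .cond_true hb h1, ?_, h3⟩
    simp only [Program.timeBound, Polynomial.eval_add, Polynomial.eval_natCast, Nat.cast_id]
    omega

/-- Run `p` with register `i` ranging over all numbers below `b`. -/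
def Program.forLoop (i : ℕ) (b : RExpr) (p : Program) : Program :=
  .seq (.setReg i (.const 0))
    (.loop (.lt (.reg i) b) (.seq p (.setReg i (.add (.reg i) (.const 1)))))

/-- The bound `b` is reevaluated in every round, so the invariant has to keep its value equal to
`N`. The postcondition of `p` already includes the increment of the counter. -/
theorem WP.forLoop {i : ℕ} {b : RExpr} {p : Program} (I : ℕ → Memory → Prop) (N : ℕ) (hN : N ≤ M)
    (hreg : ∀ j s, I j s → s.regs i = j) (hb : ∀ j s, I j s → b.eval s = N)
    (h0 : I 0 (s.setReg i 0))
    (hstep : ∀ j s, j < N → I j s → WP M p s fun s' => I (j + 1) (s'.setReg i (s'.regs i + 1)))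
    (hQ : ∀ s, I N s → Q s) : WP M (.forLoop i b p) s Q := by
  refine WP.seq (WP.setReg ?_)
  set c : RExpr := .lt (.reg i) b with hc
  set body : Program := .seq p (.setReg i (.add (.reg i) (.const 1))) with hbody
  -- Here `k` is the number of rounds left; the extra summand pays for the final failing test.
  have key : ∀ k j s, j + k = N → I j s → ∃ t s', Runs (.loop c body) s t s' ∧
      t ≤ k * (c.steps + 1 + body.timeBound.eval M) + (c.steps + 1) ∧ Q s' := by
    intro k
    induction k with
    | zero =>
      intro j s hj hI
      obtain rfl : j = N := by omega
      refine ⟨_, s, .loop_done ?_, by omega, hQ s hI⟩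
      simp [hc, RExpr.eval, hreg j s hI, hb j s hI]
    | succ k ih =>
      intro j s hj hI
      have hbd : WP M body s (I (j + 1)) := by
        refine WP.seq ((hstep j s (by omega) hI).mono fun s' hs' => WP.setReg ?_)
        simpa [RExpr.eval] using hs'
      obtain ⟨t, s', h1, h2, h3⟩ := hbd
      obtain ⟨t', s'', h4, h5, h6⟩ := ih (j + 1) s' (by omega) h3
      refine ⟨_, s'', .loop_again ?_ h1 h4, ?_, h6⟩
      · simp only [hc, RExpr.eval, hreg j s hI, hb j s hI]
        rw [if_pos (by omega)]
        exact one_ne_zero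
      · rw [Nat.succ_mul]
        omega
  obtain ⟨t, s', h1, h2, h3⟩ := key N 0 _ (by omega) h0
  refine ⟨t, s', h1, h2.trans ?_, h3⟩
  simp only [Program.timeBound, Polynomial.eval_add, Polynomial.eval_natCast, Nat.cast_id,
    Polynomial.eval_mul, Polynomial.eval_X]
  gcongr

/-! ### Memory updates and frame conditions -/

@[simp] theorem Memory.regs_setReg (s : Memory) (x v y : ℕ) :
    (s.setReg x v).regs y = if y = x then v else s.regs y := by
  simp [Memory.setReg, Function.update_apply]

@[simp] theorem Memory.arrays_setReg (s : Memory) (x v : ℕ) :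
    (s.setReg x v).arrays = s.arrays := rfl

@[simp] theorem Memory.regs_setCell (s : Memory) (A i v : ℕ) :
    (s.setCell A i v).regs = s.regs := rfl

@[simp] theorem Memory.arrays_setCell (s : Memory) (A i v A' : ℕ) :
    (s.setCell A i v).arrays A' =
      if A' = A then Function.update (s.arrays A) i v else s.arrays A' := by
  simp only [Memory.setCell, Function.update_apply]

/-- `s'` differs from `s` at most in the registers in `R` and the arrays in `A`. -/
structure Memory.Frame (R A : List ℕ) (s s' : Memory) : Prop where
  regs : ∀ x, x ∉ R → s'.regs x = s.regs x
  arrays : ∀ a, a ∉ A → s'.arrays a = s.arrays a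

theorem Memory.Frame.refl (R A : List ℕ) (s : Memory) : Memory.Frame R A s s :=
  ⟨fun _ _ => rfl, fun _ _ => rfl⟩

theorem Memory.Frame.trans {R A R' A' : List ℕ} {s s' s'' : Memory} (h : Memory.Frame R A s s')
    (h' : Memory.Frame R' A' s' s'') (hR : R' ⊆ R) (hA : A' ⊆ A) : Memory.Frame R A s s'' :=
  ⟨fun x hx => (h'.regs x fun hh => hx (hR hh)).trans (h.regs x hx),
    fun a ha => (h'.arrays a fun hh => ha (hA hh)).trans (h.arrays a ha)⟩

theorem Memory.Frame.setReg {R A : List ℕ} {s s' : Memory} (h : Memory.Frame R A s s') (x v : ℕ)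
    (hx : x ∈ R) : Memory.Frame R A s (s'.setReg x v) := by
  refine ⟨fun y hy => ?_, h.arrays⟩
  have hne : y ≠ x := fun hh => hy (hh.symm ▸ hx)
  rw [Memory.regs_setReg, if_neg hne, h.regs y hy]

theorem Memory.Frame.setCell {R A : List ℕ} {s s' : Memory} (h : Memory.Frame R A s s')
    (a i v : ℕ) (ha : a ∈ A) : Memory.Frame R A s (s'.setCell a i v) := by
  refine ⟨h.regs, fun b hb => ?_⟩
  have hne : b ≠ a := fun hh => hb (hh.symm ▸ ha)
  rw [Memory.arrays_setCell, if_neg hne, h.arrays b hb]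

end LiquidDemocracy

namespace LiquidDemocracy

/-! ### Computing reachable sets

Memory layout. Registers: `0` the number of agents, `1` the number of ballot edges, `2` the sum of
their weights; the others are local variables. Arrays: `0` the input, `1` the output, `2`, `3`, `4`
the sources, targets and positions of the edges, `5` their reduced weights, `6` the times when they
became tight, `7` the marks of the reachability search, `8` the marks of the tree. -/

/-- The agents' edges of the delegation graph, enumerated by the numbers below `m`. -/
structure EdgeList {n : ℕ} (B : Profile n) (m : ℕ) (ed : ℕ → Vertex n × Vertex n) : Prop where
  mem : ∀ e < m, ∃ a i, ed e = (.agent a, (B a).entry i)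
  surj : ∀ a i, ∃ e < m, ed e = (.agent a, (B a).entry i)

/-- The memory holds the given list of edges. -/
structure Loaded {n : ℕ} (B : Profile n) (m K : ℕ) (ed : ℕ → Vertex n × Vertex n)
    (s : Memory) : Prop where
  reg_agents : s.regs 0 = n
  reg_edges : s.regs 1 = m
  reg_total : s.regs 2 = K
  source : ∀ e < m, s.arrays 2 e = (ed e).1.code
  target : ∀ e < m, s.arrays 3 e = (ed e).2.code
  position : ∀ e < m, s.arrays 4 e = (delegationGraph B).weight (ed e)

variable {n : ℕ} {B : Profile n} {m K M : ℕ} {ed : ℕ → Vertex n × Vertex n} {s s' : Memory}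
  {w : Vertex n × Vertex n → ℕ}

theorem Loaded.frame {R A : List ℕ} (h : Loaded B m K ed s) (hf : Memory.Frame R A s s')
    (hR : ∀ x < 3, x ∉ R) (hA : ∀ a, 2 ≤ a → a ≤ 4 → a ∉ A) : Loaded B m K ed s' where
  reg_agents := by rw [hf.regs 0 (hR 0 (by omega)), h.reg_agents]
  reg_edges := by rw [hf.regs 1 (hR 1 (by omega)), h.reg_edges]
  reg_total := by rw [hf.regs 2 (hR 2 (by omega)), h.reg_total]
  source := by rw [hf.arrays 2 (hA 2 (by omega) (by omega))]; exact h.source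
  target := by rw [hf.arrays 3 (hA 3 (by omega) (by omega))]; exact h.target
  position := by rw [hf.arrays 4 (hA 4 (by omega) (by omega))]; exact h.position

theorem EdgeList.edge_mem (hE : EdgeList B m ed) {e : ℕ} (he : e < m) :
    ed e ∈ (delegationGraph B).edges := by
  obtain ⟨a, i, h⟩ := hE.mem e he
  rw [h]
  exact agent_entry_mem B a i

theorem EdgeList.target_ne_root (hE : EdgeList B m ed) {e : ℕ} (he : e < m) :
    (ed e).2 ≠ .root := by
  obtain ⟨a, i, h⟩ := hE.mem e he
  rw [h]
  exact (B a).entry_ne_root i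

theorem EdgeList.source_ne_root (hE : EdgeList B m ed) {e : ℕ} (he : e < m) :
    (ed e).1 ≠ .root := by
  obtain ⟨a, i, h⟩ := hE.mem e he
  rw [h]
  simp

/-- The list omits exactly the edges from alternatives to the root, so the searches of the program
never need marks at the root. -/
theorem EdgeList.exists_index (hE : EdgeList B m ed) {e : Vertex n × Vertex n}
    (he : e ∈ (delegationGraph B).edges) (hr : e.2 ≠ .root) : ∃ k < m, ed k = e := by
  obtain ⟨u, v⟩ := e
  rcases mem_delegationGraph.1 he with ⟨_, h⟩ | ⟨a, i, rfl, rfl⟩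
  · exact absurd h hr
  · exact hE.surj a i

theorem Vertex.code_lt_of_ne_root {v : Vertex n} (h : v ≠ .root) : v.code < n + 2 := by
  cases v <;> simp only [Vertex.code] <;> first | omega | exact absurd rfl h

/-- Array `A` holds the indicator function of `S`. -/
def Marks (A : ℕ) (S : Finset (Vertex n)) (s : Memory) : Prop :=
  ∀ v : Vertex n, v ≠ .root → s.arrays A v.code = if v ∈ S then 1 else 0

theorem Marks.insert {A : ℕ} {S : Finset (Vertex n)} (h : Marks A S s) (v : Vertex n)
    (hA : s'.arrays A = Function.update (s.arrays A) v.code 1) : Marks A (insert v S) s' := by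
  intro x hx
  rw [hA, Function.update_apply]
  by_cases hxv : x = v
  · simp [hxv]
  · rw [if_neg fun hh => hxv (Vertex.code_injective hh), h x hx]
    simp [hxv]

theorem Marks.congr {A : ℕ} {S : Finset (Vertex n)} (h : Marks A S s)
    (hA : s'.arrays A = s.arrays A) : Marks A S s' := by
  intro x hx
  rw [hA, h x hx]

/-- The codes below `n + 2` are exactly those of the vertices other than the root, so summing marks
counts `S`. -/
theorem Marks.sum_eq {A : ℕ} {S : Finset (Vertex n)} (h : Marks A S s) (hr : .root ∉ S) :
    ∑ x ∈ Finset.range (n + 2), s.arrays A x = S.card := by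
  classical
  have hsub : S.image Vertex.code ⊆ Finset.range (n + 2) := by
    intro x hx
    obtain ⟨v, hv, rfl⟩ := Finset.mem_image.1 hx
    exact Finset.mem_range.2 (Vertex.code_lt_of_ne_root fun hh => hr (hh ▸ hv))
  rw [← Finset.sum_subset hsub, Finset.sum_image fun _ _ _ _ h => Vertex.code_injective h,
    Finset.sum_congr rfl (g := fun _ => 1), Finset.card_eq_sum_ones]
  · intro v hv
    rw [h v fun hh => hr (hh ▸ hv), if_pos hv]
  · intro x hx hnx
    have hex : ∃ v : Vertex n, v ≠ .root ∧ v.code = x := by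
      rw [Finset.mem_range] at hx
      by_cases hxn : x < n
      · exact ⟨.agent ⟨x, hxn⟩, by simp, rfl⟩
      · refine ⟨.alt ⟨x - n, by omega⟩, by simp, ?_⟩
        simp only [Vertex.code]
        omega
    obtain ⟨v, hv, rfl⟩ := hex
    rw [h v hv, if_neg]
    exact fun hh => hnx (Finset.mem_image_of_mem _ hh)

/-- The edges of the delegation graph whose reduced weight is zero. -/
def zeroEdges (B : Profile n) (w : Vertex n × Vertex n → ℕ) : Finset (Vertex n × Vertex n) :=
  (delegationGraph B).edges.filter fun e => w e = 0

theorem mem_zeroEdges {e : Vertex n × Vertex n} :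
    e ∈ zeroEdges B w ↔ e ∈ (delegationGraph B).edges ∧ w e = 0 :=
  Finset.mem_filter

/-- Clear the marks. -/
def clearProg : Program :=
  .forLoop 8 (.add (.reg 0) (.const 2)) (.setCell 7 (.reg 8) (.const 0))

/-- Mark the targets of all edges of weight zero with a marked source. -/
def spreadProg : Program :=
  .forLoop 9 (.reg 1)
    (.cond (.lt (.cell 5 (.reg 9)) (.cell 7 (.cell 2 (.reg 9))))
      (.setCell 7 (.cell 3 (.reg 9)) (.const 1)) .skip)

/-- Mark the vertices reachable from the one in register `7` along edges of weight zero. -/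
def reachProg : Program :=
  .seq clearProg
    (.seq (.setCell 7 (.reg 7) (.const 1))
      (.forLoop 8 (.add (.reg 0) (.const 2)) spreadProg))

theorem wp_clear (hL : Loaded B m K ed s) (hM : n + 3 ≤ M) :
    WP M clearProg s fun s' => Memory.Frame [8] [7] s s' ∧ ∀ x < n + 2, s'.arrays 7 x = 0 := by
  refine WP.forLoop (fun j s' => Memory.Frame [8] [7] s s' ∧ s'.regs 8 = j ∧
    ∀ x < j, s'.arrays 7 x = 0) (n + 2) (by omega) (fun j s' h => h.2.1) ?_ ?_ ?_ ?_
  · rintro j s' ⟨hf, -, -⟩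
    simp [RExpr.eval, (hL.frame hf (by simp; omega) (by simp; omega)).reg_agents]
  · exact ⟨(Memory.Frame.refl _ _ _).setReg _ _ (by simp), by simp, by simp⟩
  · rintro j s' hj ⟨hf, hr, hx⟩
    refine WP.setCell ⟨(hf.setCell _ _ _ (by simp)).setReg _ _ (by simp), by simp [hr], ?_⟩
    intro x hxj
    simp only [RExpr.eval, hr, Memory.arrays_setReg, Memory.arrays_setCell, if_true,
      Function.update_apply]
    split_ifs with h
    · rfl
    · exact hx x (by omega)
  · rintro s' ⟨hf, -, hx⟩
    exact ⟨hf, hx⟩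

/-- Marks are updated in place, so one pass may spread along several edges. Only the spread from the
initial set `S` is guaranteed, and soundness is kept by staying inside the reachable set. -/
theorem wp_spread (hL : Loaded B m K ed s) (hE : EdgeList B m ed) (hM : m ≤ M)
    (hw : ∀ e < m, s.arrays 5 e = w (ed e)) {u : Vertex n} {S : Finset (Vertex n)}
    (hS : Marks 7 S s) (hr : .root ∉ S) (hsub : S ⊆ reachable (zeroEdges B w) u) :
    WP M spreadProg s fun s' => Memory.Frame [9] [7] s s' ∧ ∃ S', Marks 7 S' s' ∧ S ⊆ S' ∧
      .root ∉ S' ∧ S' ⊆ reachable (zeroEdges B w) u ∧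
      ∀ e < m, w (ed e) = 0 → (ed e).1 ∈ S → (ed e).2 ∈ S' := by
  refine WP.forLoop (fun j s' => Memory.Frame [9] [7] s s' ∧ s'.regs 9 = j ∧
      ∃ S', Marks 7 S' s' ∧ S ⊆ S' ∧ .root ∉ S' ∧ S' ⊆ reachable (zeroEdges B w) u ∧
      ∀ e < j, w (ed e) = 0 → (ed e).1 ∈ S → (ed e).2 ∈ S') m hM (fun j s' h => h.2.1) ?_ ?_ ?_ ?_
  · rintro j s' ⟨hf, -, -⟩
    simp [RExpr.eval, (hL.frame hf (by simp; omega) (by simp; omega)).reg_edges]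
  · exact ⟨(Memory.Frame.refl _ _ _).setReg _ _ (by simp), by simp, S, hS.congr rfl,
      subset_rfl, hr, hsub, by simp⟩
  · rintro j s' hj ⟨hf, hreg, S', h1, h2, h3, h4, h5⟩
    have hL' := hL.frame hf (by simp; omega) (by simp; omega)
    have hw' : s'.arrays 5 j = w (ed j) := by rw [hf.arrays 5 (by simp), hw j hj]
    have hval : (RExpr.lt (.cell 5 (.reg 9)) (.cell 7 (.cell 2 (.reg 9)))).eval s' ≠ 0 ↔
        w (ed j) = 0 ∧ (ed j).1 ∈ S' := by
      simp only [RExpr.eval, hreg, hL'.source j hj, hw', h1 _ (hE.source_ne_root hj)]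
      split_ifs <;> simp_all
    refine WP.cond (fun hc => WP.setCell ?_) (fun hc => WP.skip ?_)
    · obtain ⟨h6, h7⟩ := hval.1 hc
      refine ⟨(hf.setCell _ _ _ (by simp)).setReg _ _ (by simp), by simp [hreg],
        insert (ed j).2 S', ?_, h2.trans (Finset.subset_insert _ _), ?_, ?_, ?_⟩
      · exact h1.insert _ (by simp [RExpr.eval, hreg, hL'.target j hj])
      · simp [h3, (hE.target_ne_root hj).symm]
      · refine Finset.insert_subset ?_ h4
        rw [mem_reachable]
        exact Relation.ReflTransGen.tail (mem_reachable.1 (h4 h7))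
          (mem_zeroEdges.2 ⟨hE.edge_mem hj, h6⟩)
      · intro e he g1 g2
        rcases Nat.lt_succ_iff_lt_or_eq.1 he with he | rfl
        · exact Finset.mem_insert_of_mem (h5 e he g1 g2)
        · exact Finset.mem_insert_self _ _
    · refine ⟨hf.setReg _ _ (by simp), by simp [hreg], S', h1.congr rfl, h2, h3, h4, ?_⟩
      intro e he g1 g2
      rcases Nat.lt_succ_iff_lt_or_eq.1 he with he | rfl
      · exact h5 e he g1 g2
      · exact absurd hc (hval.2 ⟨g1, h2 g2⟩)
  · rintro s' ⟨hf, -, h⟩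
    exact ⟨hf, h⟩

/-- A set containing `u` and closed under edges of weight zero contains all vertices other than the
root that are reachable from `u`. -/
theorem EdgeList.mem_of_closed (hE : EdgeList B m ed) {u : Vertex n} {S : Finset (Vertex n)}
    (hu : u ∈ S) (hcl : ∀ e < m, w (ed e) = 0 → (ed e).1 ∈ S → (ed e).2 ∈ S) {v : Vertex n}
    (h : Reach (zeroEdges B w) u v) (hv : v ≠ .root) : v ∈ S := by
  by_contra hvS
  obtain ⟨e, he, h1, h2⟩ := h.exists_exit (fun x => x ∈ S ∨ x = .root) (Or.inl hu) (by tauto)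
  rw [mem_zeroEdges] at he
  push Not at h2
  obtain ⟨k, hk, hek⟩ := hE.exists_index he.1 h2.2
  rcases h1 with h1 | h1
  · exact h2.1 (hek ▸ hcl k hk (hek ▸ he.2) (hek ▸ h1))
  · exact delegationGraph_no_out_root (B := B) e.2 (h1 ▸ he.1)

theorem wp_reach (hL : Loaded B m K ed s) (hE : EdgeList B m ed) (hm : m ≤ M) (hM : n + 3 ≤ M)
    (hw : ∀ e < m, s.arrays 5 e = w (ed e)) {u : Vertex n} (hu : u ≠ .root)
    (hreg : s.regs 7 = u.code) :
    WP M reachProg s fun s' => Memory.Frame [8, 9] [7] s s' ∧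
      Marks 7 (reachable (zeroEdges B w) u) s' := by
  refine WP.seq ((wp_clear hL hM).mono ?_)
  rintro s₁ ⟨hf₁, h0⟩
  refine WP.seq (WP.setCell ?_)
  set s₂ := s₁.setCell 7 ((RExpr.reg 7).eval s₁) ((RExpr.const 1).eval s₁) with hs₂
  have hf₂ : Memory.Frame [8, 9] [7] s s₂ :=
    (((Memory.Frame.refl _ _ _).trans hf₁ (by simp) (by simp)).setCell _ _ _ (by simp))
  have hmark : Marks 7 {u} s₂ := by
    have h : Marks 7 (∅ : Finset (Vertex n)) s₁ := by
      intro v hv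
      simp [h0 _ (Vertex.code_lt_of_ne_root hv)]
    have h' := h.insert (s' := s₂) u (by simp [hs₂, RExpr.eval, hf₁.regs 7 (by simp), hreg])
    simpa using h'
  -- Each pass either finds the marked set closed or enlarges it. After `n + 2` passes the
  -- cardinality alternative would demand `n + 3` vertices other than the root, which do not exist.
  refine WP.forLoop (fun j s' => Memory.Frame [8, 9] [7] s s' ∧ s'.regs 8 = j ∧
    ∃ S : Finset (Vertex n), Marks 7 S s' ∧ u ∈ S ∧ .root ∉ S ∧
      S ⊆ reachable (zeroEdges B w) u ∧
      ((∀ v, Reach (zeroEdges B w) u v → v ≠ .root → v ∈ S) ∨ j + 1 ≤ S.card))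
    (n + 2) (by omega) (fun j s' h => h.2.1) ?_ ?_ ?_ ?_
  · rintro j s' ⟨hf, -, -⟩
    simp [RExpr.eval, (hL.frame hf (by simp; omega) (by simp; omega)).reg_agents]
  · refine ⟨hf₂.setReg _ _ (by simp), by simp, {u}, hmark.congr rfl, by simp, ?_, ?_, by simp⟩
    · simpa using hu.symm
    · simp only [Finset.singleton_subset_iff, mem_reachable]
      exact Relation.ReflTransGen.refl
  · rintro j s' hj ⟨hf, hreg, S, h1, h2, h3, h4, h5⟩
    have hL' := hL.frame hf (by simp; omega) (by simp; omega)
    refine (wp_spread hL' hE hm (w := w) (fun e he => ?_) h1 h3 h4).mono ?_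
    · rw [hf.arrays 5 (by simp), hw e he]
    rintro s'' ⟨hf', S', g1, g2, g3, g4, g5⟩
    refine ⟨(hf.trans hf' (by simp) (by simp)).setReg _ _ (by simp), ?_, S', g1.congr rfl, g2 h2,
      g3, g4, ?_⟩
    · simp [hf'.regs 8 (by simp), hreg]
    · rcases h5 with h5 | h5
      · exact Or.inl fun v hv hvr => g2 (h5 v hv hvr)
      · by_cases hSS : S = S'
        · subst hSS
          exact Or.inl fun v hv hvr => hE.mem_of_closed h2 g5 hv hvr
        · right
          have := Finset.card_lt_card (Finset.ssubset_iff_subset_ne.2 ⟨g2, hSS⟩)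
          omega
  · rintro s' ⟨hf, -, S, h1, h2, h3, h4, h5⟩
    refine ⟨hf, fun v hv => ?_⟩
    have h6 : ∀ v, Reach (zeroEdges B w) u v → v ≠ .root → v ∈ S := by
      rcases h5 with h5 | h5
      · exact h5
      · exfalso
        have h7 : S.card < Fintype.card (Vertex n) := by
          rw [← Finset.card_univ]
          exact Finset.card_lt_card (Finset.ssubset_univ_iff.2 fun hh => h3 (by simp [hh]))
        have := Vertex.card_le n
        omega
    rw [h1 v hv]
    have : v ∈ S ↔ v ∈ reachable (zeroEdges B w) u :=
      ⟨fun hh => h4 hh, fun hh => h6 v (mem_reachable.1 hh) hv⟩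
    simp [this]

end LiquidDemocracy

namespace LiquidDemocracy

/-! ### The dual phase of the program -/

variable {n : ℕ} {B : Profile n} {m K M : ℕ} {ed : ℕ → Vertex n × Vertex n} {s s' : Memory}
  {w : Vertex n × Vertex n → ℕ}

/-- Count the marks. -/
def countProg : Program :=
  .seq (.setReg 11 (.const 0))
    (.forLoop 8 (.add (.reg 0) (.const 2)) (.setReg 11 (.add (.reg 11) (.cell 7 (.reg 8)))))

/-- Find an agent that does not reach an alternative and whose reachable set is smallest. -/
def selectProg : Program :=
  .seq (.setReg 10 (.add (.reg 0) (.const 3)))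
    (.forLoop 7 (.reg 0)
      (.seq reachProg
        (.seq countProg
          (.cond (.add (.cell 7 (.reg 0)) (.cell 7 (.add (.reg 0) (.const 1)))) .skip
            (.cond (.lt (.reg 11) (.reg 10))
              (.seq (.setReg 10 (.reg 11)) (.setReg 12 (.reg 7))) .skip)))))

/-- Decrease the weights of the edges leaving the marked set by one, and record the time for those
that become tight. -/
def lowerProg : Program :=
  .forLoop 9 (.reg 1)
    (.cond (.lt (.cell 7 (.cell 3 (.reg 9))) (.cell 7 (.cell 2 (.reg 9))))
      (.seq (.setCell 5 (.reg 9) (.sub (.cell 5 (.reg 9)) (.const 1)))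
        (.cond (.cell 5 (.reg 9)) .skip (.setCell 6 (.reg 9) (.add (.reg 13) (.const 1)))))
      .skip)

/-- One iteration of the dual phase. -/
def raiseProg : Program :=
  .seq selectProg
    (.cond (.lt (.reg 10) (.add (.reg 0) (.const 3)))
      (.seq (.setReg 7 (.reg 12)) (.seq reachProg lowerProg)) .skip)

/-- The dual phase. -/
def dualProg : Program := .forLoop 13 (.reg 2) raiseProg

/-! ### Correctness of the dual phase -/

theorem wp_count (hL : Loaded B m K ed s) (hM : n + 3 ≤ M) :
    WP M countProg s fun s' => Memory.Frame [8, 11] [] s s' ∧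
      s'.regs 11 = ∑ x ∈ Finset.range (n + 2), s.arrays 7 x := by
  refine WP.seq (WP.setReg ?_)
  refine WP.forLoop (fun j s' => Memory.Frame [8, 11] [] s s' ∧ s'.regs 8 = j ∧
    s'.regs 11 = ∑ x ∈ Finset.range j, s.arrays 7 x) (n + 2) (by omega)
    (fun j s' h => h.2.1) ?_ ?_ ?_ ?_
  · rintro j s' ⟨hf, -, -⟩
    simp [RExpr.eval, (hL.frame hf (by simp; omega) (by simp)).reg_agents]
  · exact ⟨((Memory.Frame.refl _ _ _).setReg _ _ (by simp)).setReg _ _ (by simp), by simp,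
      by simp [RExpr.eval]⟩
  · rintro j s' hj ⟨hf, hr, hx⟩
    refine WP.setReg ⟨(hf.setReg _ _ (by simp)).setReg _ _ (by simp), by simp [hr], ?_⟩
    simp [RExpr.eval, hr, hx, hf.arrays 7 (by simp), Finset.sum_range_succ]
  · rintro s' ⟨hf, -, hx⟩
    exact ⟨hf, hx⟩

/-- The marks do not cover the root, so the program tests the two alternatives instead. -/
theorem reach_root_iff (hwalt : ∀ d, w (.alt d, .root) = 0) (a : Fin n) :
    Reach (zeroEdges B w) (.agent a) .root ↔
      ∃ d, Reach (zeroEdges B w) (.agent a) (.alt d) := by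
  constructor
  · intro h
    rcases Relation.ReflTransGen.cases_tail h with heq | ⟨v, hv, he⟩
    · simp at heq
    · obtain ⟨d, rfl⟩ := delegationGraph_source_of_root (mem_zeroEdges.1 he).1
      exact ⟨d, hv⟩
  · rintro ⟨d, hd⟩
    exact Relation.ReflTransGen.tail hd (mem_zeroEdges.2 ⟨alt_root_mem B d, hwalt d⟩)

theorem alt_reach_root (hwalt : ∀ d, w (.alt d, .root) = 0) (d : Fin 2) :
    Reach (zeroEdges B w) (.alt d) .root :=
  Relation.ReflTransGen.single (mem_zeroEdges.2 ⟨alt_root_mem B d, hwalt d⟩)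

theorem card_reachable_lt {u : Vertex n} (hu : ¬ Reach (zeroEdges B w) u .root) :
    (reachable (zeroEdges B w) u).card < n + 3 := by
  refine lt_of_lt_of_le ?_ (Vertex.card_le n)
  rw [← Finset.card_univ]
  refine Finset.card_lt_card (Finset.ssubset_univ_iff.2 fun hh => hu ?_)
  rw [← mem_reachable, hh]
  simp

/-- The initial value `n + 3` of register `10` exceeds every reachable set that avoids the root, so
it serves as the sign that no agent was found. Agents suffice as candidates because the alternatives
always reach the root. -/
theorem wp_select (hL : Loaded B m K ed s) (hE : EdgeList B m ed) (hm : m ≤ M) (hM : n + 3 ≤ M)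
    (hw : ∀ e < m, s.arrays 5 e = w (ed e)) (hwalt : ∀ d, w (.alt d, .root) = 0) :
    WP M selectProg s fun s' => Memory.Frame [7, 8, 9, 10, 11, 12] [7] s s' ∧
      ((s'.regs 10 = n + 3 ∧ ∀ u, Reach (zeroEdges B w) u .root) ∨
        (s'.regs 10 < n + 3 ∧ ∃ a : Fin n, s'.regs 12 = a ∧
          ¬ Reach (zeroEdges B w) (.agent a) .root ∧
          ∀ x, ¬ Reach (zeroEdges B w) x .root →
            (reachable (zeroEdges B w) (.agent a)).card ≤
              (reachable (zeroEdges B w) x).card)) := by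
  refine WP.seq (WP.setReg ?_)
  refine WP.forLoop (fun j s' => Memory.Frame [7, 8, 9, 10, 11, 12] [7] s s' ∧ s'.regs 7 = j ∧
    (∀ b : Fin n, (b : ℕ) < j → ¬ Reach (zeroEdges B w) (.agent b) .root →
      s'.regs 10 ≤ (reachable (zeroEdges B w) (.agent b)).card) ∧
    (s'.regs 10 = n + 3 ∨ ∃ a : Fin n, s'.regs 12 = a ∧
      ¬ Reach (zeroEdges B w) (.agent a) .root ∧
      s'.regs 10 = (reachable (zeroEdges B w) (.agent a)).card)) n (by omega)
    (fun j s' h => h.2.1) ?_ ?_ ?_ ?_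
  · rintro j s' ⟨hf, -, -⟩
    simp [RExpr.eval, (hL.frame hf (by simp; omega) (by simp; omega)).reg_agents]
  · exact ⟨((Memory.Frame.refl _ _ _).setReg _ _ (by simp)).setReg _ _ (by simp), by simp,
      by simp, by simp [RExpr.eval, hL.reg_agents]⟩
  · rintro j s' hj ⟨hf, hr, hmin, hsel⟩
    have hL' := hL.frame hf (by simp; omega) (by simp; omega)
    have hw' : ∀ e < m, s'.arrays 5 e = w (ed e) := by rwa [hf.arrays 5 (by simp)]
    refine WP.seq ((wp_reach hL' hE hm hM hw' (u := .agent ⟨j, hj⟩) (by simp) hr).mono ?_)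
    rintro s₁ ⟨hf₁, hmark⟩
    have hL₁ := hL'.frame hf₁ (by simp; omega) (by simp; omega)
    refine WP.seq ((wp_count hL₁ hM).mono ?_)
    rintro s₂ ⟨hf₂, hcnt⟩
    have hL₂ := hL₁.frame hf₂ (by simp; omega) (by simp)
    have hfr : Memory.Frame [7, 8, 9, 10, 11, 12] [7] s s₂ :=
      (hf.trans hf₁ (by simp) (by simp)).trans hf₂ (by simp) (by simp)
    have h7 : s₂.regs 7 = j := by
      rw [hf₂.regs 7 (by simp), hf₁.regs 7 (by simp), hr]
    have h10 : s₂.regs 10 = s'.regs 10 := by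
      rw [hf₂.regs 10 (by simp), hf₁.regs 10 (by simp)]
    have h12 : s₂.regs 12 = s'.regs 12 := by
      rw [hf₂.regs 12 (by simp), hf₁.regs 12 (by simp)]
    have hmark₂ := hmark.congr (hf₂.arrays 7 (by simp))
    -- Cells `n` and `n + 1` are the marks of the alternatives; their sum acts as a disjunction.
    have hval : (RExpr.add (.cell 7 (.reg 0)) (.cell 7 (.add (.reg 0) (.const 1)))).eval s₂ ≠ 0 ↔
        Reach (zeroEdges B w) (.agent ⟨j, hj⟩) .root := by
      have e0 := hmark₂ (.alt 0) (by simp)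
      have e1 := hmark₂ (.alt 1) (by simp)
      simp only [Vertex.code, Fin.val_zero, Fin.val_one, add_zero] at e0 e1
      simp only [RExpr.eval, hL₂.reg_agents, e0, e1, reach_root_iff hwalt, Fin.exists_fin_two,
        ← mem_reachable]
      split_ifs <;> simp_all
    have hmin' : ∀ k ≤ s'.regs 10, (¬ Reach (zeroEdges B w) (.agent ⟨j, hj⟩) .root →
        k ≤ (reachable (zeroEdges B w) (.agent ⟨j, hj⟩)).card) →
        ∀ b : Fin n, (b : ℕ) < j + 1 → ¬ Reach (zeroEdges B w) (.agent b) .root →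
          k ≤ (reachable (zeroEdges B w) (.agent b)).card := by
      intro k hk hkj b hb hbr
      rcases Nat.lt_succ_iff_lt_or_eq.1 hb with hb | hb
      · exact hk.trans (hmin b hb hbr)
      · obtain rfl : b = ⟨j, hj⟩ := Fin.ext hb
        exact hkj hbr
    refine WP.cond (fun hc => WP.skip ?_) (fun hc => ?_)
    · refine ⟨hfr.setReg _ _ (by simp), by simp [h7], ?_, by simpa [h10, h12] using hsel⟩
      have := hmin' _ le_rfl fun hh => absurd (hval.1 hc) hh
      simpa [h10] using this
    · have hnr : ¬ Reach (zeroEdges B w) (.agent ⟨j, hj⟩) .root := fun hh => hval.2 hh hc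
      have hcard : s₂.regs 11 = (reachable (zeroEdges B w) (.agent ⟨j, hj⟩)).card := by
        rw [hcnt, hmark.sum_eq (by rwa [mem_reachable])]
      refine WP.cond (fun hc' => WP.seq (WP.setReg (WP.setReg ?_))) (fun hc' => WP.skip ?_)
      · have hlt : s₂.regs 11 < s₂.regs 10 := by
          by_contra hh
          simp [RExpr.eval, hh] at hc'
        refine ⟨((hfr.setReg _ _ (by simp)).setReg _ _ (by simp)).setReg _ _ (by simp),
          by simp [h7], ?_, Or.inr ⟨⟨j, hj⟩, ?_, hnr, ?_⟩⟩
        · have := hmin' (s₂.regs 11) (by omega) fun _ => hcard.le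
          simpa [RExpr.eval] using this
        · simp [RExpr.eval, h7]
        · simp [RExpr.eval, hcard]
      · have hle : s₂.regs 10 ≤ s₂.regs 11 := by
          by_contra hh
          simp [RExpr.eval, not_le.1 hh] at hc'
        refine ⟨hfr.setReg _ _ (by simp), by simp [h7], ?_, by simpa [h10, h12] using hsel⟩
        have := hmin' _ le_rfl fun _ => by omega
        simpa [h10] using this
  · rintro s' ⟨hf, -, hmin, hsel⟩
    refine ⟨hf, ?_⟩
    by_cases h10 : s'.regs 10 = n + 3
    · left
      refine ⟨h10, fun u => ?_⟩
      cases u with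
      | root => exact Relation.ReflTransGen.refl
      | alt d => exact alt_reach_root hwalt d
      | agent a =>
        by_contra ha
        have := hmin a a.2 ha
        have := card_reachable_lt ha
        omega
    · right
      rcases hsel with hsel | ⟨a, h12, ha, hcard⟩
      · exact absurd hsel h10
      · refine ⟨hcard ▸ card_reachable_lt ha, a, h12, ha, fun x hx => ?_⟩
        cases x with
        | root => exact absurd Relation.ReflTransGen.refl hx
        | alt d => exact absurd (alt_reach_root hwalt d) hx
        | agent b => exact hcard ▸ hmin b b.2 hx

/-- The reduced weights `w` and the times `τ` are stored in memory. -/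
structure Stored (m : ℕ) (ed : ℕ → Vertex n × Vertex n) (w τ : Vertex n × Vertex n → ℕ)
    (s : Memory) : Prop where
  weight : ∀ e < m, s.arrays 5 e = w (ed e)
  time : ∀ e < m, w (ed e) = 0 → s.arrays 6 e = τ (ed e)

theorem Stored.congr {τ : Vertex n × Vertex n → ℕ} (h : Stored m ed w τ s)
    (h5 : s'.arrays 5 = s.arrays 5) (h6 : s'.arrays 6 = s.arrays 6) : Stored m ed w τ s' where
  weight := by rw [h5]; exact h.weight
  time := by rw [h6]; exact h.time

theorem wp_lower {st : FulkersonState (Vertex n)} {τ : Vertex n × Vertex n → ℕ}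
    {L : Finset (Vertex n)} {k : ℕ} (hL : Loaded B m K ed s) (hE : EdgeList B m ed) (hm : m ≤ M)
    (hs : Stored m ed st.weight τ s) (hmark : Marks 7 L s) (hk : s.regs 13 = k)
    (hpos : ∀ e ∈ (delegationGraph B).leaving L, 1 ≤ st.weight e) :
    WP M lowerProg s fun s' => Memory.Frame [9] [5, 6] s s' ∧
      Stored m ed (st.reduce (delegationGraph B) L 1)
        (fun e => if st.weight e = 0 then τ e else k + 1) s' := by
  set w' := st.reduce (delegationGraph B) L 1 with hw'
  set τ' : Vertex n × Vertex n → ℕ := fun e => if st.weight e = 0 then τ e else k + 1 with hτ'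
  -- Entries below `j` hold the new weights and times, and those from `j` on are still the old ones.
  refine WP.forLoop (fun j s' => Memory.Frame [9] [5, 6] s s' ∧ s'.regs 9 = j ∧
      Stored j ed w' τ' s' ∧
      ∀ e, j ≤ e → s'.arrays 5 e = s.arrays 5 e ∧ s'.arrays 6 e = s.arrays 6 e) m hm
    (fun j s' h => h.2.1) ?_ ?_ ?_ ?_
  · rintro j s' ⟨hf, -, -⟩
    simp [RExpr.eval, (hL.frame hf (by simp; omega) (by simp; omega)).reg_edges]
  · exact ⟨(Memory.Frame.refl _ _ _).setReg _ _ (by simp), by simp, ⟨by simp, by simp⟩, by simp⟩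
  · rintro j s' hj ⟨hf, hr, hst, hrest⟩
    have hL' := hL.frame hf (by simp; omega) (by simp; omega)
    have hmark' := hmark.congr (hf.arrays 7 (by simp))
    have h5 : s'.arrays 5 j = st.weight (ed j) := by rw [(hrest j le_rfl).1, hs.weight j hj]
    have hval : (RExpr.lt (.cell 7 (.cell 3 (.reg 9))) (.cell 7 (.cell 2 (.reg 9)))).eval s' ≠ 0 ↔
        ed j ∈ (delegationGraph B).leaving L := by
      simp only [RExpr.eval, hr, hL'.source j hj, hL'.target j hj,
        hmark' _ (hE.source_ne_root hj), hmark' _ (hE.target_ne_root hj), WDigraph.leaving,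
        Finset.mem_filter, hE.edge_mem hj, true_and]
      split_ifs <;> simp_all
    have hk' : s'.regs 13 = k := by rw [hf.regs 13 (by simp), hk]
    refine WP.cond (fun hc => WP.seq (WP.setCell ?_)) (fun hc => WP.skip ?_)
    · have hlv := hval.1 hc
      have hwj : w' (ed j) = st.weight (ed j) - 1 := by simp [hw', FulkersonState.reduce, hlv]
      have hτj : τ' (ed j) = k + 1 := by
        have := hpos _ hlv
        simp only [hτ']
        rw [if_neg (by omega)]
      refine WP.cond (fun hc' => WP.skip ?_) (fun hc' => WP.setCell ?_)
      · simp only [RExpr.eval, hr, h5, Memory.regs_setCell, Memory.arrays_setCell, if_true,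
          Function.update_self] at hc'
        refine ⟨(hf.setCell _ _ _ (by simp)).setReg _ _ (by simp), by simp [hr], ⟨?_, ?_⟩, ?_⟩
        · intro e he
          rcases Nat.lt_succ_iff_lt_or_eq.1 he with he | rfl
          · simpa [RExpr.eval, hr, he.ne] using hst.weight e he
          · simp [RExpr.eval, hr, h5, hwj]
        · intro e he h0
          rcases Nat.lt_succ_iff_lt_or_eq.1 he with he | rfl
          · simpa using hst.time e he h0
          · exact absurd (hwj ▸ h0) hc'
        · intro e he
          have hne : e ≠ j := by omega
          simpa [RExpr.eval, hr, hne] using hrest e (by omega)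
      · simp only [RExpr.eval, hr, h5, Memory.regs_setCell, Memory.arrays_setCell, if_true,
          Function.update_self] at hc'
        refine ⟨((hf.setCell _ _ _ (by simp)).setCell _ _ _ (by simp)).setReg _ _ (by simp),
          by simp [hr], ⟨?_, ?_⟩, ?_⟩
        · intro e he
          rcases Nat.lt_succ_iff_lt_or_eq.1 he with he | rfl
          · simpa [RExpr.eval, hr, he.ne] using hst.weight e he
          · simp [RExpr.eval, hr, h5, hwj]
        · intro e he h0
          rcases Nat.lt_succ_iff_lt_or_eq.1 he with he | rfl
          · simpa [RExpr.eval, hr, he.ne] using hst.time e he h0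
          · simp [RExpr.eval, hr, hτj, hk']
        · intro e he
          have hne : e ≠ j := by omega
          simpa [RExpr.eval, hr, hne] using hrest e (by omega)
    · have hlv : ed j ∉ (delegationGraph B).leaving L := fun hh => hval.2 hh hc
      have hwj : w' (ed j) = st.weight (ed j) := by simp [hw', FulkersonState.reduce, hlv]
      refine ⟨hf.setReg _ _ (by simp), by simp [hr], ⟨?_, ?_⟩, ?_⟩
      · intro e he
        rcases Nat.lt_succ_iff_lt_or_eq.1 he with he | rfl
        · exact hst.weight e he
        · simp [h5, hwj]
      · intro e he h0
        rcases Nat.lt_succ_iff_lt_or_eq.1 he with he | rfl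
        · exact hst.time e he h0
        · rw [hwj] at h0
          simp [hτ', h0, (hrest e le_rfl).2, hs.time e hj h0]
      · intro e he
        simpa using hrest e (by omega)
  · rintro s' ⟨hf, -, hst, -⟩
    exact ⟨hf, hst⟩

/-- The invariant of the dual phase after `j` iterations. -/
structure DualInv (B : Profile n) (m K : ℕ) (ed : ℕ → Vertex n × Vertex n) (j : ℕ)
    (st : FulkersonState (Vertex n)) (τ : Vertex n × Vertex n → ℕ) (s : Memory) : Prop where
  stored : Stored m ed st.weight τ s
  inv : FulkersonInv (delegationGraph B) st τ
  tight_eq : st.tight = zeroEdges B st.weight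
  weight_alt : ∀ d, st.weight (.alt d, .root) = 0
  time_le : ∀ e ∈ st.tight, τ e ≤ j
  progress : ∑ e ∈ Finset.range m, st.weight (ed e) + j ≤ K ∨ ∀ u, Reach st.tight u .root

variable {st : FulkersonState (Vertex n)} {τ : Vertex n × Vertex n → ℕ} {j : ℕ}

/-- In the program all edges of weight zero are tight, and no tight edge leaves an eligible set.
This makes a unit decrement admissible. -/
theorem DualInv.one_le_weight (h : DualInv B m K ed j st τ s) {L : Finset (Vertex n)}
    (hL : st.Eligible (delegationGraph B) L) :
    ∀ e ∈ (delegationGraph B).leaving L, 1 ≤ st.weight e := by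
  intro e he
  have h1 := Finset.mem_filter.1 he
  rw [Nat.one_le_iff_ne_zero]
  intro h0
  have h2 : e ∈ st.tight := by
    rw [h.tight_eq]
    exact mem_zeroEdges.2 ⟨h1.1, h0⟩
  exact h1.2.2 (hL.mem_of_tight h.inv.tight_subset h2 h1.2.1)

/-- Old tight edges have times at most `j`, so the stamp `j + 1` puts the new ones strictly later.
Edges that already had weight zero are not on the cut. -/
theorem DualInv.raise (h : DualInv B m K ed j st τ s) (hE : EdgeList B m ed)
    {L : Finset (Vertex n)} (hL : st.Eligible (delegationGraph B) L)
    (hs' : Stored m ed (st.reduce (delegationGraph B) L 1)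
        (fun e => if st.weight e = 0 then τ e else j + 1) s') :
    DualInv B m K ed (j + 1) (st.raise (delegationGraph B) L 1)
      (fun e => if st.weight e = 0 then τ e else j + 1) s' where
  stored := hs'
  inv := by
    refine h.inv.raise delegationGraph_no_loop hL (h.one_le_weight hL) ?_ ?_
    · intro e he
      simp [h.inv.weight_tight e he]
    · intro e he e' he' hne
      have h1 := h.time_le e he
      have h2 : st.weight e' ≠ 0 := by
        intro h0
        rcases Finset.mem_union.1 he' with he' | he'
        · exact hne he'
        · have := h.one_le_weight hL e' (Finset.mem_filter.1 he').1
          omega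
      simp only [h2, if_false]
      omega
  tight_eq := by
    ext e
    simp only [FulkersonState.raise, h.tight_eq, Finset.mem_union, mem_zeroEdges]
    rw [Finset.mem_filter]
    unfold FulkersonState.reduce
    by_cases he : e ∈ (delegationGraph B).leaving L
    · have h1 := (Finset.mem_filter.1 he).1
      have h2 := h.one_le_weight hL e he
      simp only [he, h1, if_true, true_and]
      omega
    · simp [he]
  weight_alt := by
    intro d
    have := h.weight_alt d
    simp only [FulkersonState.raise, FulkersonState.reduce]
    split_ifs <;> omega
  time_le := by
    intro e he
    split_ifs with h0
    · have h1 : e ∈ st.tight := by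
        rcases Finset.mem_union.1 he with he | he
        · exact he
        · have := h.one_le_weight hL e (Finset.mem_filter.1 he).1
          omega
      have := h.time_le e h1
      omega
    · exact le_rfl
  progress := by
    have hle : ∀ e, st.reduce (delegationGraph B) L 1 e ≤ st.weight e := by
      intro e
      unfold FulkersonState.reduce
      split_ifs <;> omega
    rcases h.progress with hp | hp
    · left
      obtain ⟨u, hu⟩ := hL.nonempty
      -- Some edge leaves `L`. It has positive weight, so it is not an edge into the root and
      -- appears in the list; the total listed weight therefore drops.
      obtain ⟨e, he, h1, h2⟩ :=
        (delegationGraph_reach_root (B := B) u).exists_exit (· ∈ L) hu hL.2.1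
      have hlv : e ∈ (delegationGraph B).leaving L := Finset.mem_filter.2 ⟨he, h1, h2⟩
      have hr : e.2 ≠ .root := by
        intro hr
        have hee : e = (e.1, .root) := Prod.ext rfl hr
        obtain ⟨d, hd⟩ := delegationGraph_source_of_root (B := B) (u := e.1) (hee ▸ he)
        have := h.one_le_weight hL e hlv
        rw [hee, hd, h.weight_alt d] at this
        omega
      obtain ⟨k, hk, hek⟩ := hE.exists_index he hr
      have hlt : ∑ e ∈ Finset.range m, st.reduce (delegationGraph B) L 1 (ed e) <
          ∑ e ∈ Finset.range m, st.weight (ed e) := by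
        refine Finset.sum_lt_sum (fun e _ => hle _) ⟨k, Finset.mem_range.2 hk, ?_⟩
        have := h.one_le_weight hL e hlv
        rw [hek]
        simp only [FulkersonState.reduce, hlv, if_true]
        omega
      change ∑ e ∈ Finset.range m, st.reduce (delegationGraph B) L 1 (ed e) + (j + 1) ≤ K
      omega
    · right
      exact fun u => (hp u).mono Finset.subset_union_left

theorem wp_raise (hL : Loaded B m K ed s) (hE : EdgeList B m ed) (hm : m ≤ M) (hM : n + 3 ≤ M)
    (h : DualInv B m K ed j st τ s) (hj : s.regs 13 = j) :
    WP M raiseProg s fun s' => Memory.Frame [7, 8, 9, 10, 11, 12] [5, 6, 7] s s' ∧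
      ∃ st' τ', DualInv B m K ed (j + 1) st' τ' s' := by
  refine WP.seq ((wp_select hL hE hm hM h.stored.weight h.weight_alt).mono ?_)
  rintro s₁ ⟨hf₁, hsel⟩
  have hL₁ := hL.frame hf₁ (by simp; omega) (by simp; omega)
  have hst₁ : Stored m ed st.weight τ s₁ :=
    h.stored.congr (hf₁.arrays 5 (by simp)) (hf₁.arrays 6 (by simp))
  have hfr : Memory.Frame [7, 8, 9, 10, 11, 12] [5, 6, 7] s s₁ :=
    (Memory.Frame.refl _ _ _).trans hf₁ (by simp) (by simp)
  rw [← h.tight_eq] at hsel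
  refine WP.cond (fun hc => WP.seq (WP.setReg (WP.seq ?_))) (fun hc => WP.skip ?_)
  · simp only [RExpr.eval, hL₁.reg_agents] at hc
    rcases hsel with ⟨h10, -⟩ | ⟨-, a, h12, ha, hmin⟩
    · simp [h10] at hc
    have hel : st.Eligible (delegationGraph B) (reachable st.tight (.agent a)) :=
      eligible_of_min ha hmin
    set s₂ := s₁.setReg 7 ((RExpr.reg 12).eval s₁) with hs₂
    have hf₂ : Memory.Frame [7, 8, 9, 10, 11, 12] [5, 6, 7] s s₂ := hfr.setReg _ _ (by simp)
    have hL₂ := hL.frame hf₂ (by simp; omega) (by simp; omega)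
    have hst₂ : Stored m ed st.weight τ s₂ := hst₁.congr rfl rfl
    refine (wp_reach hL₂ hE hm hM hst₂.weight (u := .agent a) (by simp)
      (by simp [hs₂, RExpr.eval, h12, Vertex.code])).mono ?_
    rintro s₃ ⟨hf₃, hmark⟩
    rw [← h.tight_eq] at hmark
    have hL₃ := hL₂.frame hf₃ (by simp; omega) (by simp; omega)
    have hst₃ : Stored m ed st.weight τ s₃ :=
      hst₂.congr (hf₃.arrays 5 (by simp)) (hf₃.arrays 6 (by simp))
    have hfr₃ := hf₂.trans hf₃ (by simp) (by simp)
    refine (wp_lower hL₃ hE hm hst₃ hmark ((hfr₃.regs 13 (by simp)).trans hj)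
      (h.one_le_weight hel)).mono ?_
    rintro s₄ ⟨hf₄, hst₄⟩
    exact ⟨hfr₃.trans hf₄ (by simp) (by simp), _, _, h.raise hE hel hst₄⟩
  · simp only [RExpr.eval, hL₁.reg_agents] at hc
    rcases hsel with ⟨-, hall⟩ | ⟨h10, -⟩
    · refine ⟨hfr, st, τ, hst₁, h.inv, h.tight_eq, h.weight_alt, ?_, Or.inr hall⟩
      exact fun e he => (h.time_le e he).trans (by omega)
    · simp [h10] at hc

/-- If progress was made in all `K` rounds, the total weight is used up. Then every edge is tight,
and the whole graph reaches the root. -/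
theorem DualInv.reach_root (h : DualInv B m K ed K st τ s) (hE : EdgeList B m ed)
    (u : Vertex n) : Reach st.tight u .root := by
  rcases h.progress with hp | hp
  · refine (delegationGraph_reach_root (B := B) u).mono fun e he => ?_
    have hsum : ∑ e ∈ Finset.range m, st.weight (ed e) = 0 := by omega
    rw [h.tight_eq, mem_zeroEdges]
    refine ⟨he, ?_⟩
    by_cases hr : e.2 = .root
    · have hee : e = (e.1, .root) := Prod.ext rfl hr
      obtain ⟨d, hd⟩ := delegationGraph_source_of_root (B := B) (u := e.1) (hee ▸ he)
      rw [hee, hd, h.weight_alt d]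
    · obtain ⟨k, hk, rfl⟩ := hE.exists_index he hr
      exact Finset.sum_eq_zero_iff.1 hsum k (Finset.mem_range.2 hk)
  · exact hp u

theorem wp_dual (hL : Loaded B m K ed s) (hE : EdgeList B m ed) (hm : m ≤ M) (hM : n + 3 ≤ M)
    (hK : K ≤ M) (h : DualInv B m K ed 0 st τ s) :
    WP M dualProg s fun s' => Memory.Frame [7, 8, 9, 10, 11, 12, 13] [5, 6, 7] s s' ∧
      ∃ st' τ', DualInv B m K ed K st' τ' s' := by
  refine WP.forLoop (fun j s' => Memory.Frame [7, 8, 9, 10, 11, 12, 13] [5, 6, 7] s s' ∧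
    s'.regs 13 = j ∧ ∃ st' τ', DualInv B m K ed j st' τ' s') K hK (fun j s' h => h.2.1) ?_ ?_ ?_ ?_
  · rintro j s' ⟨hf, -, -⟩
    simp [RExpr.eval, (hL.frame hf (by simp; omega) (by simp; omega)).reg_total]
  · exact ⟨(Memory.Frame.refl _ _ _).setReg _ _ (by simp), by simp, st, τ,
      { h with stored := h.stored.congr rfl rfl }⟩
  · rintro j s' hj ⟨hf, hr, st', τ', h'⟩
    refine (wp_raise (hL.frame hf (by simp; omega) (by simp; omega)) hE hm hM h' hr).mono ?_
    rintro s'' ⟨hf', st'', τ'', h''⟩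
    exact ⟨(hf.trans hf' (by simp) (by simp)).setReg _ _ (by simp),
      by simp [hf'.regs 13 (by simp), hr], st'', τ'',
      { h'' with stored := h''.stored.congr rfl rfl }⟩
  · rintro s' ⟨hf, -, h'⟩
    exact ⟨hf, h'⟩

end LiquidDemocracy

namespace LiquidDemocracy

/-! ### The primal phase of the program -/

variable {n : ℕ} {B : Profile n} {m K M : ℕ} {ed : ℕ → Vertex n × Vertex n} {s s' : Memory}
  {st : FulkersonState (Vertex n)} {τ : Vertex n × Vertex n → ℕ} {S : Finset (Vertex n)}

/-- Find an earliest tight edge that enters the tree. -/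
def searchProg : Program :=
  .seq (.setReg 10 (.add (.reg 2) (.const 1)))
    (.forLoop 9 (.reg 1)
      (.cond (.lt (.cell 5 (.reg 9)) (.cell 8 (.cell 3 (.reg 9))))
        (.cond (.cell 8 (.cell 2 (.reg 9))) .skip
          (.cond (.lt (.cell 6 (.reg 9)) (.reg 10))
            (.seq (.setReg 10 (.cell 6 (.reg 9))) (.setReg 12 (.reg 9))) .skip))
        .skip))

/-- Add an agent to the tree if possible, and the alternative `0` otherwise. -/
def growProg : Program :=
  .seq searchProg
    (.cond (.lt (.reg 10) (.add (.reg 2) (.const 1)))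
      (.seq (.setCell 1 (.cell 2 (.reg 12)) (.cell 4 (.reg 12)))
        (.setCell 8 (.cell 2 (.reg 12)) (.const 1)))
      (.setCell 8 (.reg 0) (.const 1)))

/-- The primal phase. -/
def treeProg : Program :=
  .seq (.setCell 8 (.add (.reg 0) (.const 1)) (.const 1))
    (.forLoop 13 (.add (.reg 0) (.const 1)) growProg)

/-! ### Correctness of the primal phase -/

/-- Edge number `e` is tight and enters the vertex set `S`. -/
def Candidate (ed : ℕ → Vertex n × Vertex n) (st : FulkersonState (Vertex n))
    (S : Finset (Vertex n)) (e : ℕ) : Prop :=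
  st.weight (ed e) = 0 ∧ (ed e).1 ∉ S ∧ (ed e).2 ∈ S

/-- Times are at most `K` after the dual phase, so `K + 1` is a safe sign that no candidate exists.
-/
theorem wp_search (hL : Loaded B m K ed s) (hE : EdgeList B m ed) (hm : m ≤ M)
    (h : DualInv B m K ed K st τ s) (hS : Marks 8 S s) :
    WP M searchProg s fun s' => Memory.Frame [9, 10, 12] [] s s' ∧
      ((s'.regs 10 = K + 1 ∧ ∀ e < m, ¬ Candidate ed st S e) ∨
        (s'.regs 10 < K + 1 ∧ ∃ e < m, s'.regs 12 = e ∧ Candidate ed st S e ∧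
          ∀ e' < m, Candidate ed st S e' → τ (ed e) ≤ τ (ed e'))) := by
  have htime : ∀ e < m, Candidate ed st S e → τ (ed e) ≤ K := by
    intro e he hc
    refine h.time_le _ ?_
    rw [h.tight_eq]
    exact mem_zeroEdges.2 ⟨hE.edge_mem he, hc.1⟩
  refine WP.seq (WP.setReg ?_)
  refine WP.forLoop (fun j s' => Memory.Frame [9, 10, 12] [] s s' ∧ s'.regs 9 = j ∧
    (∀ e < j, Candidate ed st S e → s'.regs 10 ≤ τ (ed e)) ∧
    (s'.regs 10 = K + 1 ∨ ∃ e < m, s'.regs 12 = e ∧ Candidate ed st S e ∧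
      s'.regs 10 = τ (ed e))) m hm (fun j s' h => h.2.1) ?_ ?_ ?_ ?_
  · rintro j s' ⟨hf, -, -⟩
    simp [RExpr.eval, (hL.frame hf (by simp; omega) (by simp)).reg_edges]
  · exact ⟨((Memory.Frame.refl _ _ _).setReg _ _ (by simp)).setReg _ _ (by simp), by simp,
      by simp, by simp [RExpr.eval, hL.reg_total]⟩
  · rintro j s' hj ⟨hf, hr, hmin, hsel⟩
    have hL' := hL.frame hf (by simp; omega) (by simp)
    have hS' := hS.congr (hf.arrays 8 (by simp))
    have hst : Stored m ed st.weight τ s' :=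
      h.stored.congr (hf.arrays 5 (by simp)) (hf.arrays 6 (by simp))
    have hval : (RExpr.lt (.cell 5 (.reg 9)) (.cell 8 (.cell 3 (.reg 9)))).eval s' ≠ 0 ↔
        st.weight (ed j) = 0 ∧ (ed j).2 ∈ S := by
      simp only [RExpr.eval, hr, hL'.target j hj, hst.weight j hj, hS' _ (hE.target_ne_root hj)]
      split_ifs <;> simp_all
    have hval' : (RExpr.cell 8 (.cell 2 (.reg 9))).eval s' ≠ 0 ↔ (ed j).1 ∈ S := by
      simp only [RExpr.eval, hr, hL'.source j hj, hS' _ (hE.source_ne_root hj)]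
      split_ifs <;> simp_all
    have hmin' : ∀ k ≤ s'.regs 10, (Candidate ed st S j → k ≤ τ (ed j)) →
        ∀ e < j + 1, Candidate ed st S e → k ≤ τ (ed e) := by
      intro k hk hkj e he hc
      rcases Nat.lt_succ_iff_lt_or_eq.1 he with he | rfl
      · exact hk.trans (hmin e he hc)
      · exact hkj hc
    have hkeep : (Candidate ed st S j → s'.regs 10 ≤ τ (ed j)) →
        Memory.Frame [9, 10, 12] [] s (s'.setReg 9 (s'.regs 9 + 1)) ∧
        (s'.setReg 9 (s'.regs 9 + 1)).regs 9 = j + 1 ∧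
        (∀ e < j + 1, Candidate ed st S e →
          (s'.setReg 9 (s'.regs 9 + 1)).regs 10 ≤ τ (ed e)) ∧
        ((s'.setReg 9 (s'.regs 9 + 1)).regs 10 = K + 1 ∨
          ∃ e < m, (s'.setReg 9 (s'.regs 9 + 1)).regs 12 = e ∧ Candidate ed st S e ∧
            (s'.setReg 9 (s'.regs 9 + 1)).regs 10 = τ (ed e)) := by
      intro hh
      refine ⟨hf.setReg _ _ (by simp), by simp [hr], ?_, by simpa using hsel⟩
      simpa using hmin' _ le_rfl hh
    refine WP.cond (fun hc => WP.cond (fun hc' => WP.skip (hkeep fun hh => ?_)) (fun hc' => ?_))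
      (fun hc => WP.skip (hkeep fun hh => ?_))
    · exact absurd (hval'.1 hc') hh.2.1
    · have hcand : Candidate ed st S j :=
        ⟨(hval.1 hc).1, fun hh => hval'.2 hh hc', (hval.1 hc).2⟩
      have h6 : s'.arrays 6 j = τ (ed j) := hst.time j hj hcand.1
      refine WP.cond (fun hc'' => WP.seq (WP.setReg (WP.setReg ?_)))
        (fun hc'' => WP.skip (hkeep fun hh => ?_))
      · have hlt : τ (ed j) < s'.regs 10 := by
          by_contra hh
          simp [RExpr.eval, hr, h6, hh] at hc''
        refine ⟨((hf.setReg _ _ (by simp)).setReg _ _ (by simp)).setReg _ _ (by simp),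
          by simp [hr], ?_, Or.inr ⟨j, hj, by simp [RExpr.eval, hr], hcand, ?_⟩⟩
        · have := hmin' (τ (ed j)) (by omega) fun _ => le_rfl
          simpa [RExpr.eval, hr, h6] using this
        · simp [RExpr.eval, hr, h6]
      · by_contra hlt
        simp [RExpr.eval, hr, h6, not_le.1 hlt] at hc''
    · exact absurd hc (hval.2 ⟨hh.1, hh.2.2⟩)
  · rintro s' ⟨hf, -, hmin, hsel⟩
    refine ⟨hf, ?_⟩
    rcases hsel with hsel | ⟨e, he, h12, hc, h10⟩
    · refine Or.inl ⟨hsel, fun e he hc => ?_⟩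
      have := hmin e he hc
      have := htime e he hc
      omega
    · refine Or.inr ⟨?_, e, he, h12, hc, fun e' he' hc' => h10 ▸ hmin e' he' hc'⟩
      have := htime e he hc
      omega

/-- The invariant of the primal phase after `j` iterations. -/
def TreeInv (B : Profile n) (st : FulkersonState (Vertex n)) (j : ℕ) (s : Memory) : Prop :=
  ∃ S T, GreedyTree B st S T ∧ Marks 8 S s ∧
    (∀ a : Fin n, .agent a ∈ S → ∃ i, s.arrays 1 a = i ∧ ∃ hi : i < (B a).size + 1,
      (.agent a, (B a).entry ⟨i, hi⟩) ∈ T) ∧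
    (S = Finset.univ ∨ j + 2 ≤ S.card)

theorem TreeInv.congr {j : ℕ} (h : TreeInv B st j s) (h1 : s'.arrays 1 = s.arrays 1)
    (h8 : s'.arrays 8 = s.arrays 8) : TreeInv B st j s' := by
  obtain ⟨S, T, g1, g2, g3, g4⟩ := h
  exact ⟨S, T, g1, g2.congr h8, by rwa [h1], g4⟩

theorem delegationGraph_weight_entry (a : Fin n) (i : Fin ((B a).size + 1)) :
    (delegationGraph B).weight (.agent a, (B a).entry i) = i :=
  (B a).rank_entry i

theorem wp_grow {j : ℕ} (hL : Loaded B m K ed s) (hE : EdgeList B m ed) (hm : m ≤ M)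
    (h : DualInv B m K ed K st τ s) (ht : TreeInv B st j s) :
    WP M growProg s fun s' => Memory.Frame [9, 10, 12] [1, 8] s s' ∧ TreeInv B st (j + 1) s' := by
  obtain ⟨S, T, hT, hS, hpos, hcard⟩ := ht
  have hreach := h.reach_root hE
  refine WP.seq ((wp_search hL hE hm h hS).mono ?_)
  rintro s₁ ⟨hf, hsel⟩
  have hL₁ := hL.frame hf (by simp; omega) (by simp)
  have hS₁ := hS.congr (hf.arrays 8 (by simp))
  rw [← hf.arrays 1 (by simp)] at hpos
  have hf' : Memory.Frame [9, 10, 12] [1, 8] s s₁ :=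
    (Memory.Frame.refl _ _ _).trans hf (by simp) (by simp)
  have hindex : ∀ e' ∈ st.tight, e'.1 ∉ S → e'.2 ∈ S → e'.2 ≠ .root →
      ∃ k < m, ed k = e' ∧ Candidate ed st S k := by
    intro e' he' g1 g2 g3
    obtain ⟨k, hk, rfl⟩ := hE.exists_index (h.inv.tight_subset he') g3
    exact ⟨k, hk, rfl, h.inv.weight_tight _ he', g1, g2⟩
  refine WP.cond (fun hc => WP.seq (WP.setCell (WP.setCell ?_))) (fun hc => WP.setCell ?_)
  · simp only [RExpr.eval, hL₁.reg_total] at hc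
    rcases hsel with ⟨h10, -⟩ | ⟨-, e, he, h12, hcand, hmin⟩
    · simp [h10] at hc
    obtain ⟨a, i, hai⟩ := hE.mem e he
    have htight : ed e ∈ st.tight := by
      rw [h.tight_eq]
      exact mem_zeroEdges.2 ⟨hE.edge_mem he, hcand.1⟩
    have haS : .agent a ∉ S := by simpa [hai] using hcand.2.1
    have hsrc : s₁.arrays 2 e = a := by rw [hL₁.source e he, hai]; rfl
    have hposi : s₁.arrays 4 e = i := by
      rw [hL₁.position e he, hai, delegationGraph_weight_entry]
    refine ⟨(hf'.setCell _ _ _ (by simp)).setCell _ _ _ (by simp), insert (.agent a) S,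
      insert (.agent a, (B a).entry i) T, ?_, ?_, ?_, ?_⟩
    · refine hT.add_agent h.inv (hai ▸ htight) haS (by simpa [hai] using hcand.2.2)
        ((B a).entry_ne_root i) ?_
      intro e' g1 g2 g3 g4
      obtain ⟨k, hk, rfl, hck⟩ := hindex e' g1 g2 g3 g4
      rw [← hai]
      exact hmin k hk hck
    · exact hS₁.insert _ (by simp [RExpr.eval, h12, hsrc, Vertex.code])
    · intro b hb
      by_cases hba : b = a
      · subst hba
        exact ⟨i, by simp [RExpr.eval, h12, hsrc, hposi], i.2, by simp⟩
      · obtain ⟨i', g1, g2, g3⟩ := hpos b (by simpa [hba] using hb)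
        refine ⟨i', ?_, g2, Finset.mem_insert_of_mem g3⟩
        simp [RExpr.eval, h12, hsrc, Fin.val_inj, hba, g1]
    · right
      rcases hcard with hcard | hcard
      · exact absurd (hcard ▸ Finset.mem_univ _) haS
      · rw [Finset.card_insert_of_notMem haS]
        omega
  · simp only [RExpr.eval, hL₁.reg_total] at hc
    rcases hsel with ⟨-, hnone⟩ | ⟨h10, -⟩
    swap
    · simp [h10] at hc
    have hstuck : ∀ e' ∈ st.tight, e'.1 ∉ S → e'.2 ∈ S → e'.2 = .root := by
      intro e' g1 g2 g3
      by_contra g4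
      obtain ⟨k, hk, -, hck⟩ := hindex e' g1 g2 g3 g4
      exact hnone k hk hck
    refine ⟨hf'.setCell _ _ _ (by simp), ?_⟩
    have hmark := hS₁.insert (s' := s₁.setCell 8 ((RExpr.reg 0).eval s₁)
      ((RExpr.const 1).eval s₁)) (.alt 0) (by simp [RExpr.eval, hL₁.reg_agents, Vertex.code])
    -- If `0` is already in the tree, being stuck means that the tree spans, and marking `0` again
    -- is harmless.
    by_cases h0 : .alt 0 ∈ S
    · rw [Finset.insert_eq_of_mem h0] at hmark
      exact ⟨S, T, hT, hmark, by simpa using hpos,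
        Or.inl (Finset.eq_univ_iff_forall.2 (hT.spanning h.inv hreach h0 hstuck))⟩
    · refine ⟨insert (.alt 0) S, _, hT.add_alt h.inv hreach h0 hstuck, hmark, ?_, ?_⟩
      · intro a ha
        obtain ⟨i, g1, g2, g3⟩ := hpos a (by simpa using ha)
        exact ⟨i, by simpa using g1, g2, Finset.mem_insert_of_mem g3⟩
      · right
        rcases hcard with hcard | hcard
        · exact absurd (hcard ▸ Finset.mem_univ _) h0
        · rw [Finset.card_insert_of_notMem h0]
          omega

theorem DualInv.frame {R A : List ℕ} {j : ℕ} (h : DualInv B m K ed j st τ s)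
    (hf : Memory.Frame R A s s') (h5 : 5 ∉ A) (h6 : 6 ∉ A) : DualInv B m K ed j st τ s' :=
  { h with stored := h.stored.congr (hf.arrays 5 h5) (hf.arrays 6 h6) }

/-- Positions selecting edges of an arborescence select exactly that arborescence. -/
theorem certificateEdges_eq {T : Finset (Vertex n × Vertex n)}
    (hT : IsArborescence (delegationGraph B) T) (c : Certificate B)
    (hc : ∀ a, (.agent a, (B a).entry (c a)) ∈ T) : certificateEdges B c = T := by
  ext ⟨u, v⟩
  simp only [certificateEdges, Finset.mem_union, Finset.mem_image, Finset.mem_univ, true_and,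
    Prod.mk.injEq]
  constructor
  · rintro (⟨d, rfl, rfl⟩ | ⟨a, rfl, rfl⟩)
    · obtain ⟨v, hv, _⟩ := hT.unique_out (.alt d) (by simp [delegationGraph])
      rwa [← delegationGraph_target_alt (hT.subset hv)]
    · exact hc a
  · intro huv
    rcases mem_delegationGraph.1 (hT.subset huv) with ⟨⟨d, rfl⟩, rfl⟩ | ⟨a, i, rfl, hv⟩
    · exact Or.inl ⟨d, rfl, rfl⟩
    · exact Or.inr ⟨a, rfl,
        (hT.unique_out (.agent a) (by simp [delegationGraph])).unique (hc a) huv⟩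

theorem wp_tree (hL : Loaded B m K ed s) (hE : EdgeList B m ed) (hm : m ≤ M) (hM : n + 3 ≤ M)
    (h : DualInv B m K ed K st τ s) (h8 : s.arrays 8 = fun _ => 0) :
    WP M treeProg s fun s' => ∃ c : Certificate B, s'.HoldsCertificate c ∧
      IsMinCostArborescence (delegationGraph B) (certificateEdges B c) ∧
      ∀ a ∈ supporters B, Votes (certificateEdges B c) a 1 := by
  have hreach := h.reach_root hE
  refine WP.seq (WP.setCell ?_)
  set s₁ := s.setCell 8 ((RExpr.add (.reg 0) (.const 1)).eval s) ((RExpr.const 1).eval s) with hs₁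
  have hf₁ : Memory.Frame [9, 10, 12, 13] [1, 8] s s₁ :=
    (Memory.Frame.refl _ _ _).setCell _ _ _ (by simp)
  have h0 : TreeInv B st 0 s₁ := by
    refine ⟨_, _, GreedyTree.start h.inv hreach, ?_, by simp, Or.inr ?_⟩
    · intro v hv
      have hcode : v.code = n + 1 ↔ v = .alt 1 :=
        ⟨fun hh => Vertex.code_injective (hh.trans rfl), fun hh => hh ▸ rfl⟩
      simp [hs₁, h8, RExpr.eval, hL.reg_agents, Function.update_apply, hv, hcode]
    · rw [Finset.card_pair (by simp)]
  refine WP.forLoop (fun j s' => Memory.Frame [9, 10, 12, 13] [1, 8] s s' ∧ s'.regs 13 = j ∧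
    TreeInv B st j s') (n + 1) (by omega) (fun j s' h => h.2.1) ?_ ?_ ?_ ?_
  · rintro j s' ⟨hf, -, -⟩
    simp [RExpr.eval, (hL.frame hf (by simp; omega) (by simp; omega)).reg_agents]
  · exact ⟨hf₁.setReg _ _ (by simp), by simp, h0.congr rfl rfl⟩
  · rintro j s' hj ⟨hf, hr, ht⟩
    refine (wp_grow (hL.frame hf (by simp; omega) (by simp; omega)) hE hm
      (h.frame hf (by simp) (by simp)) ht).mono ?_
    rintro s'' ⟨hf', ht'⟩
    exact ⟨(hf.trans hf' (by simp) (by simp)).setReg _ _ (by simp),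
      by simp [hf'.regs 13 (by simp), hr], ht'.congr rfl rfl⟩
  · rintro s' ⟨-, -, S, T, hT, -, hpos, hcard⟩
    -- The tree starts with two vertices and gains one per round until it spans; `n + 1` rounds
    -- reach all `n + 3`.
    have hS : ∀ u, u ∈ S := by
      rw [← Finset.eq_univ_iff_forall]
      rcases hcard with hcard | hcard
      · exact hcard
      · apply Finset.eq_univ_of_card
        have := Finset.card_le_univ S
        have := Vertex.card_le n
        omega
    choose c hc hlt hcT using fun a => hpos a (hS _)
    have hmin := hT.toPartialTree.isMinCost h.inv hS
    have heq : certificateEdges B (fun a => ⟨c a, hlt a⟩) = T :=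
      certificateEdges_eq hmin.1 _ hcT
    refine ⟨fun a => ⟨c a, hlt a⟩, hc, heq ▸ hmin, fun a ha => ?_⟩
    rw [heq]
    exact hT.reach_of_mem (hS _) _ ((mem_supporters_iff h.inv hreach a).1 ha)

end LiquidDemocracy

namespace LiquidDemocracy

/-! ### Reading the input -/

section Blocks

variable {n : ℕ} {β : Type*}

/-- The position of the `j`-th block in a concatenation of `n` lists. -/
def blockStart (f : Fin n → List β) (j : ℕ) : ℕ := (((List.finRange n).take j).flatMap f).length

theorem blockStart_zero (f : Fin n → List β) : blockStart f 0 = 0 := by simp [blockStart]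

theorem blockStart_succ (f : Fin n → List β) (a : Fin n) :
    blockStart f (a + 1) = blockStart f a + (f a).length := by
  have h : (List.finRange n).take (a + 1) = (List.finRange n).take a ++ [a] := by
    rw [List.take_add_one, List.getElem?_eq_getElem (by simp)]
    simp
  simp [blockStart, h]

theorem blockStart_eq_length (f : Fin n → List β) :
    blockStart f n = ((List.finRange n).flatMap f).length := by
  rw [blockStart, List.take_of_length_le (by simp)]

theorem getD_blockStart (f : Fin n → List β) (a : Fin n) {i : ℕ} (hi : i < (f a).length) (d : β) :
    ((List.finRange n).flatMap f).getD (blockStart f a + i) d = (f a)[i] := by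
  have h : List.finRange n = (List.finRange n).take a ++ a :: (List.finRange n).drop (a + 1) := by
    conv_lhs => rw [← List.take_append_drop (a : ℕ) (List.finRange n)]
    rw [List.drop_eq_getElem_cons (by simp)]
    simp
  have h' : (List.finRange n).flatMap f = ((List.finRange n).take a).flatMap f ++
      (f a ++ ((List.finRange n).drop (a + 1)).flatMap f) := by
    conv_lhs => rw [h]
    rw [List.flatMap_append, List.flatMap_cons]
  rw [h', blockStart, List.getD_append_right _ _ _ _ (by omega), Nat.add_sub_cancel_left,
    List.getD_append _ _ _ _ hi, List.getD_eq_getElem _ _ hi]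

theorem length_le_blockStart (f : Fin n → List β) (a : Fin n) :
    (f a).length ≤ blockStart f n := by
  rw [blockStart_eq_length, List.length_flatMap]
  exact List.le_sum_of_mem (List.mem_map_of_mem (List.mem_finRange a))

theorem blockStart_le {γ : Type*} (f : Fin n → List β) (g : Fin n → List γ)
    (h : ∀ a, (f a).length ≤ (g a).length) : ∀ j ≤ n, blockStart f j ≤ blockStart g j := by
  intro j
  induction j with
  | zero => simp [blockStart_zero]
  | succ j ih =>
    intro hj
    have h1 := blockStart_succ f ⟨j, hj⟩
    have h2 := blockStart_succ g ⟨j, hj⟩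
    have h3 := h ⟨j, hj⟩
    have h4 := ih (by omega)
    simp only at h1 h2
    omega

end Blocks

variable {n : ℕ} {B : Profile n} {M : ℕ} {s s' : Memory}

/-- The part of the input describing the ballot of `a`. -/
def inputBlock (B : Profile n) (a : Fin n) : List ℕ :=
  (B a).size :: ((B a).delegates.map Fin.val ++ [((B a).backup : ℕ)])

/-- The edges leaving agent `a`, in the order of its ballot. -/
def edgeBlock (B : Profile n) (a : Fin n) : List (Vertex n × Vertex n) :=
  (List.finRange ((B a).size + 1)).map fun i => (.agent a, (B a).entry i)

/-- The enumeration of the agents' edges. -/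
def edgeAt (B : Profile n) (e : ℕ) : Vertex n × Vertex n :=
  ((List.finRange n).flatMap (edgeBlock B)).getD e (.root, .root)

theorem encodeProfile_eq (B : Profile n) :
    encodeProfile B = n :: (List.finRange n).flatMap (inputBlock B) := rfl

theorem length_inputBlock (a : Fin n) : (inputBlock B a).length = (B a).size + 2 := by
  simp [inputBlock, Ballot.size]

theorem length_edgeBlock (a : Fin n) : (edgeBlock B a).length = (B a).size + 1 := by
  simp [edgeBlock]

theorem edgeAt_blockStart (a : Fin n) (i : Fin ((B a).size + 1)) :
    edgeAt B (blockStart (edgeBlock B) a + i) = (.agent a, (B a).entry i) := by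
  rw [edgeAt, getD_blockStart _ a (by rw [length_edgeBlock]; exact i.2)]
  simp [edgeBlock]

theorem edgeList_edgeAt (B : Profile n) :
    EdgeList B (blockStart (edgeBlock B) n) (edgeAt B) where
  mem := by
    intro e he
    rw [blockStart_eq_length] at he
    have hmem := List.getElem_mem he
    rw [← List.getD_eq_getElem _ (.root, .root) he] at hmem
    obtain ⟨a, -, ha⟩ := List.mem_flatMap.1 hmem
    obtain ⟨i, -, hi⟩ := List.mem_map.1 ha
    exact ⟨a, i, hi.symm⟩
  surj := by
    intro a i
    have hmem : (Vertex.agent a, (B a).entry i) ∈ (List.finRange n).flatMap (edgeBlock B) :=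
      List.mem_flatMap.2 ⟨a, List.mem_finRange a, List.mem_map.2 ⟨i, List.mem_finRange i, rfl⟩⟩
    obtain ⟨e, he, hee⟩ := List.getElem_of_mem hmem
    refine ⟨e, by rwa [blockStart_eq_length], ?_⟩
    rw [edgeAt, List.getD_eq_getElem _ _ he, hee]

theorem input_size (a : Fin n) :
    (encodeProfile B).getD (1 + blockStart (inputBlock B) a) 0 = (B a).size := by
  rw [encodeProfile_eq, Nat.add_comm, List.getD_cons_succ]
  have := getD_blockStart (inputBlock B) a (i := 0) (by simp [length_inputBlock]) 0
  simpa [inputBlock] using this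

/-- The input stores an alternative as `0` or `1`, while its vertex code is shifted by `n`. Hence
the case distinction at the last position, repeated in `readEntryProg`. -/
theorem input_entry (a : Fin n) (i : Fin ((B a).size + 1)) :
    ((B a).entry i).code = (if (i : ℕ) < (B a).size then 0 else n) +
      (encodeProfile B).getD (1 + blockStart (inputBlock B) a + 1 + i) 0 := by
  have h1 : 1 + blockStart (inputBlock B) a + 1 + (i : ℕ) =
      blockStart (inputBlock B) a + (i + 1) + 1 := by omega
  rw [encodeProfile_eq, h1, List.getD_cons_succ, getD_blockStart _ a
    (by rw [length_inputBlock]; omega)]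
  simp only [inputBlock, List.getElem_cons_succ, Ballot.entry, Ballot.size]
  split_ifs with h
  · rw [List.getElem_append_left (by simpa using h)]
    simp [Vertex.code, h]
  · rw [List.getElem_append_right (by simpa using h)]
    simp [Vertex.code, h]

/-- Store the next edge of the ballot being read. -/
def readEntryProg : Program :=
  .seq (.setCell 2 (.reg 1) (.reg 4))
    (.seq (.setCell 4 (.reg 1) (.reg 6))
      (.seq (.setCell 5 (.reg 1) (.reg 6))
        (.seq
          (.cond (.lt (.reg 6) (.reg 5)) (.setCell 3 (.reg 1) (.cell 0 (.reg 3)))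
            (.setCell 3 (.reg 1) (.add (.reg 0) (.cell 0 (.reg 3)))))
          (.seq (.setReg 1 (.add (.reg 1) (.const 1)))
            (.seq (.setReg 3 (.add (.reg 3) (.const 1)))
              (.setReg 2 (.add (.reg 2) (.reg 6))))))))

/-- Read one ballot. -/
def readBallotProg : Program :=
  .seq (.setReg 5 (.cell 0 (.reg 3)))
    (.seq (.setReg 3 (.add (.reg 3) (.const 1)))
      (.forLoop 6 (.add (.reg 5) (.const 1)) readEntryProg))

/-- Read the input. -/
def readProg : Program :=
  .seq (.setReg 0 (.cell 0 (.const 0)))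
    (.seq (.setReg 3 (.const 1)) (.forLoop 4 (.reg 0) readBallotProg))

/-- The first `e` edges have been read. -/
structure ReadInv (B : Profile n) (e : ℕ) (s : Memory) : Prop where
  frame : Memory.Frame [0, 1, 2, 3, 4, 5, 6] [2, 3, 4, 5] (Memory.ofInput (encodeProfile B)) s
  loaded : Loaded B e (∑ k ∈ Finset.range e, (delegationGraph B).weight (edgeAt B k)) (edgeAt B) s
  weight : ∀ k < e, s.arrays 5 k = (delegationGraph B).weight (edgeAt B k)

theorem ReadInv.input {e : ℕ} (h : ReadInv B e s) (i : ℕ) :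
    s.arrays 0 i = (encodeProfile B).getD i 0 := by
  rw [h.frame.arrays 0 (by simp)]
  simp [Memory.ofInput]

theorem ReadInv.setReg {e : ℕ} (h : ReadInv B e s) (x v : ℕ) (hx : 3 ≤ x ∧ x ≤ 6) :
    ReadInv B e (s.setReg x v) where
  frame := h.frame.setReg _ _ (by simp; omega)
  loaded := h.loaded.frame ((Memory.Frame.refl [x] [] s).setReg x v (by simp))
    (by simp; omega) (by simp)
  weight := h.weight

theorem wp_readEntry {a : Fin n} {i : Fin ((B a).size + 1)}
    (h : ReadInv B (blockStart (edgeBlock B) a + i) s) (h3 : s.regs 3 =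
      1 + blockStart (inputBlock B) a + 1 + i) (h4 : s.regs 4 = a) (h5 : s.regs 5 = (B a).size)
    (h6 : s.regs 6 = i) :
    WP M readEntryProg s fun s' => ReadInv B (blockStart (edgeBlock B) a + i + 1) s' ∧
      s'.regs 3 = 1 + blockStart (inputBlock B) a + 1 + i + 1 ∧ s'.regs 4 = a ∧
      s'.regs 5 = (B a).size ∧ s'.regs 6 = i := by
  set e := blockStart (edgeBlock B) a + i with he
  have hed : edgeAt B e = (.agent a, (B a).entry i) := edgeAt_blockStart a i
  have hwt : (delegationGraph B).weight (edgeAt B e) = i := by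
    rw [hed, delegationGraph_weight_entry]
  have h0 := h.loaded.reg_agents
  have h1 := h.loaded.reg_edges
  have h2 := h.loaded.reg_total
  have hin := h.input (s.regs 3)
  have hcode := input_entry (B := B) a i
  rw [← h3, ← hin] at hcode
  -- The two branches of the conditional store the same target code, so the rest of the program is
  -- verified once for both.
  have key : ∀ s', s'.regs = s.regs →
      Memory.Frame [0, 1, 2, 3, 4, 5, 6] [2, 3, 4, 5] (Memory.ofInput (encodeProfile B)) s' →
      s'.arrays 2 = Function.update (s.arrays 2) e a →
      s'.arrays 3 = Function.update (s.arrays 3) e ((B a).entry i).code →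
      s'.arrays 4 = Function.update (s.arrays 4) e i →
      s'.arrays 5 = Function.update (s.arrays 5) e i →
      WP M (.seq (.setReg 1 (.add (.reg 1) (.const 1)))
            (.seq (.setReg 3 (.add (.reg 3) (.const 1)))
              (.setReg 2 (.add (.reg 2) (.reg 6))))) s' fun s' => ReadInv B (e + 1) s' ∧
      s'.regs 3 = 1 + blockStart (inputBlock B) a + 1 + i + 1 ∧ s'.regs 4 = a ∧
      s'.regs 5 = (B a).size ∧ s'.regs 6 = i := by
    intro s' hr hf a2 a3 a4 a5
    refine WP.seq (WP.setReg (WP.seq (WP.setReg (WP.setReg ⟨⟨?_, ⟨?_, ?_, ?_, ?_, ?_, ?_⟩, ?_⟩,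
      ?_, ?_, ?_, ?_⟩))))
    · exact ((hf.setReg _ _ (by simp)).setReg _ _ (by simp)).setReg _ _ (by simp)
    · simp [hr, h0]
    · simp [RExpr.eval, hr, h1]
    · simp [RExpr.eval, hr, h2, h6, Finset.sum_range_succ, hwt]
    · intro k hk
      simp only [Memory.arrays_setReg, a2, Function.update_apply]
      split_ifs with hke
      · rw [hke, hed]
        rfl
      · exact h.loaded.source k (by omega)
    · intro k hk
      simp only [Memory.arrays_setReg, a3, Function.update_apply]
      split_ifs with hke
      · rw [hke, hed]
      · exact h.loaded.target k (by omega)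
    · intro k hk
      simp only [Memory.arrays_setReg, a4, Function.update_apply]
      split_ifs with hke
      · rw [hke, hwt]
      · exact h.loaded.position k (by omega)
    · intro k hk
      simp only [Memory.arrays_setReg, a5, Function.update_apply]
      split_ifs with hke
      · rw [hke, hwt]
      · exact h.weight k (by omega)
    · simp [RExpr.eval, hr, h3]
    · simp [hr, h4]
    · simp [hr, h5]
    · simp [hr, h6]
  refine WP.seq (WP.setCell (WP.seq (WP.setCell (WP.seq (WP.setCell (WP.seq ?_))))))
  have hf := ((h.frame.setCell 2 ((RExpr.reg 1).eval s) ((RExpr.reg 4).eval s)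
    (by simp)).setCell 4 ((RExpr.reg 1).eval s) ((RExpr.reg 6).eval s)
    (by simp)).setCell 5 ((RExpr.reg 1).eval s) ((RExpr.reg 6).eval s) (by simp)
  refine WP.cond (fun hc => WP.setCell (key _ rfl (hf.setCell _ _ _ (by simp)) ?_ ?_ ?_ ?_))
    (fun hc => WP.setCell (key _ rfl (hf.setCell _ _ _ (by simp)) ?_ ?_ ?_ ?_))
  · simp [RExpr.eval, h1, h4]
  · have hlt : (i : ℕ) < (B a).size := by
      by_contra hh
      simp [RExpr.eval, h5, h6, hh] at hc
    simp [RExpr.eval, h1, hcode, hlt]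
  · simp [RExpr.eval, h1, h6]
  · simp [RExpr.eval, h1, h6]
  · simp [RExpr.eval, h1, h4]
  · have hlt : ¬ (i : ℕ) < (B a).size := by
      intro hh
      simp [RExpr.eval, h5, h6, hh] at hc
    simp [RExpr.eval, h0, h1, hcode, hlt]
  · simp [RExpr.eval, h1, h6]
  · simp [RExpr.eval, h1, h6]

theorem wp_readBallot {a : Fin n} (h : ReadInv B (blockStart (edgeBlock B) a) s)
    (h3 : s.regs 3 = 1 + blockStart (inputBlock B) a) (h4 : s.regs 4 = a)
    (hM : (B a).size + 1 ≤ M) :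
    WP M readBallotProg s fun s' => ReadInv B (blockStart (edgeBlock B) (a + 1)) s' ∧
      s'.regs 3 = 1 + blockStart (inputBlock B) (a + 1) ∧ s'.regs 4 = a := by
  refine WP.seq (WP.setReg (WP.seq (WP.setReg ?_)))
  refine WP.forLoop (fun j s' => ReadInv B (blockStart (edgeBlock B) a + j) s' ∧
    s'.regs 3 = 1 + blockStart (inputBlock B) a + 1 + j ∧ s'.regs 4 = a ∧
      s'.regs 5 = (B a).size ∧ s'.regs 6 = j) ((B a).size + 1) hM (fun j s' h => h.2.2.2.2)
      ?_ ?_ ?_ ?_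
  · rintro j s' ⟨-, -, -, h5, -⟩
    simp [RExpr.eval, h5]
  · refine ⟨((h.setReg _ _ (by omega)).setReg _ _ (by omega)).setReg _ _ (by omega), ?_, ?_, ?_,
      by simp⟩
    · simp [RExpr.eval, h3]
    · simp [h4]
    · have := input_size (B := B) a
      rw [← h.input, ← h3] at this
      simp [RExpr.eval, this]
  · rintro j s' hj ⟨g, g3, g4, g5, g6⟩
    refine (wp_readEntry (i := ⟨j, hj⟩) g g3 g4 g5 g6).mono ?_
    rintro s'' ⟨k, k3, k4, k5, k6⟩
    exact ⟨k.setReg _ _ (by omega), by simpa using k3.trans (Nat.add_assoc _ _ _),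
      by simpa using k4, by simpa using k5,
      by simp [k6]⟩
  · rintro s' ⟨g, g3, g4, -, -⟩
    rw [blockStart_succ, blockStart_succ, length_edgeBlock, length_inputBlock]
    exact ⟨g, by omega, g4⟩

theorem wp_read (hn : n ≤ M) (hM : ∀ a, (B a).size + 1 ≤ M) :
    WP M readProg (Memory.ofInput (encodeProfile B)) fun s' =>
      ReadInv B (blockStart (edgeBlock B) n) s' := by
  refine WP.seq (WP.setReg (WP.seq (WP.setReg ?_)))
  refine WP.forLoop (fun j s' => ReadInv B (blockStart (edgeBlock B) j) s' ∧
    s'.regs 3 = 1 + blockStart (inputBlock B) j ∧ s'.regs 4 = j) n hn (fun j s' h => h.2.2)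
      ?_ ?_ ?_ ?_
  · rintro j s' ⟨h, -, -⟩
    simp [RExpr.eval, h.loaded.reg_agents]
  · refine ⟨⟨?_, ?_, ?_⟩, ?_, by simp⟩
    · exact (((Memory.Frame.refl _ _ _).setReg _ _ (by simp)).setReg _ _ (by simp)).setReg _ _
        (by simp)
    · constructor <;>
        simp [blockStart_zero, RExpr.eval, Memory.ofInput, encodeProfile]
    · simp [blockStart_zero]
    · simp [blockStart_zero, RExpr.eval]
  · rintro j s' hj ⟨h, h3, h4⟩
    refine (wp_readBallot (a := ⟨j, hj⟩) h h3 h4 (hM _)).mono ?_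
    rintro s'' ⟨k, k3, k4⟩
    exact ⟨k.setReg _ _ (by omega), by simpa using k3, by simp [k4]⟩
  · rintro s' ⟨h, -, -⟩
    exact h

/-! ### The algorithm -/

/-- The algorithm: read the input, run the dual phase, then grow the tree. -/
def arborescenceProg : Program := .seq readProg (.seq dualProg treeProg)

/-- With `l` the input length, `l ^ 2 + 3` bounds every loop. The square is needed for the number
`K` of dual rounds, and the `3` accommodates the vertices besides the agents. -/
theorem wp_arborescence (B : Profile n) :
    WP ((encodeProfile B).length ^ 2 + 3) arborescenceProg (Memory.ofInput (encodeProfile B))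
      fun s' => ∃ c : Certificate B, s'.HoldsCertificate c ∧
        IsMinCostArborescence (delegationGraph B) (certificateEdges B c) ∧
        ∀ a ∈ supporters B, Votes (certificateEdges B c) a 1 := by
  set l := (encodeProfile B).length with hl
  have hlen : l = blockStart (inputBlock B) n + 1 := by
    rw [hl, encodeProfile_eq, List.length_cons, blockStart_eq_length]
  have hsq : l ≤ l ^ 2 := Nat.le_self_pow two_ne_zero l
  have hsize : ∀ a, (B a).size + 1 ≤ l := by
    intro a
    have := length_le_blockStart (inputBlock B) a
    rw [length_inputBlock] at this
    omega
  have hm : blockStart (edgeBlock B) n ≤ l := by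
    have := blockStart_le (edgeBlock B) (inputBlock B)
      (fun a => by rw [length_edgeBlock, length_inputBlock]; omega) n le_rfl
    omega
  have hn : n ≤ l := by
    have h := blockStart_le (fun _ : Fin n => [()]) (inputBlock B)
      (fun a => by simp [length_inputBlock]) n le_rfl
    rw [blockStart_eq_length] at h
    simp only [List.length_flatMap, List.length_cons, List.length_nil, List.map_const',
      List.length_finRange, List.sum_replicate, smul_eq_mul] at h
    omega
  have hE := edgeList_edgeAt B
  set m := blockStart (edgeBlock B) n with hmdef
  set K := ∑ k ∈ Finset.range m, (delegationGraph B).weight (edgeAt B k) with hKdef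
  -- There are at most `l` edges, each weighted by a ballot position below `l`.
  have hK : K ≤ l ^ 2 := by
    calc K ≤ ∑ _k ∈ Finset.range m, l := by
          refine Finset.sum_le_sum fun k hk => ?_
          obtain ⟨a, i, hai⟩ := hE.mem k (Finset.mem_range.1 hk)
          rw [hai, delegationGraph_weight_entry]
          have := hsize a
          omega
      _ = m * l := by simp
      _ ≤ l ^ 2 := by rw [pow_two]; exact Nat.mul_le_mul_right l hm
  refine WP.seq ((wp_read (by omega) (fun a => (hsize a).trans (by omega))).mono ?_)
  intro s₁ h₁
  -- Declaring all edges of weight zero tight at time `0` is sound because the family is still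
  -- empty.
  have hdual : DualInv B m K (edgeAt B) 0
      ⟨zeroEdges B (delegationGraph B).weight, ∅, (delegationGraph B).weight⟩ (fun _ => 0) s₁ :=
    { stored := ⟨h₁.weight, fun e _ _ => by rw [h₁.frame.arrays 6 (by simp)]; rfl⟩
      inv := FulkersonInv.zero_edges _ _
      tight_eq := rfl
      weight_alt := fun _ => rfl
      time_le := fun _ _ => le_rfl
      progress := Or.inl le_rfl }
  refine WP.seq ((wp_dual h₁.loaded hE (by omega) (by omega) (hK.trans (by omega)) hdual).mono ?_)
  rintro s₂ ⟨hf₂, st, τ, h₂⟩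
  refine wp_tree (h₁.loaded.frame hf₂ (by simp; omega) (by simp; omega)) hE (by omega) (by omega)
    h₂ ?_
  rw [hf₂.arrays 8 (by simp), h₁.frame.arrays 8 (by simp)]
  rfl

end LiquidDemocracy

theorem mainTheorem7 :
    (∃ (P : Program) (poly : Polynomial ℕ), ∀ (n : ℕ) (B : Profile n),
      ∃ (t : ℕ) (s : Memory) (c : Certificate B),
        Runs P (Memory.ofInput (encodeProfile B)) t s ∧
        t ≤ poly.eval (encodeProfile B).length ∧
        s.HoldsCertificate c ∧
        IsMinCostArborescence (delegationGraph B) (certificateEdges B c) ∧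
        ∀ a ∈ supporters B, Votes (certificateEdges B c) a 1) ∧
    (∀ (n : ℕ) (B : Profile n),
      (∃ E' F, IsFulkersonOutput (delegationGraph B) E' F) ∧
      ∀ E' F, IsFulkersonOutput (delegationGraph B) E' F →
        ∀ a : Fin n, a ∈ supporters B ↔ Reach E' (.agent a) (.alt 1)) := by
  refine ⟨⟨arborescenceProg, arborescenceProg.timeBound.comp (Polynomial.X ^ 2 + 3),
    fun n B => ?_⟩, fun n B => ⟨?_, fun E' F hout a => mem_supporters_iff_of_output hout a⟩⟩
  · obtain ⟨t, s, hrun, ht, c, hc⟩ := wp_arborescence B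
    refine ⟨t, s, c, hrun, ?_, hc⟩
    simpa [Polynomial.eval_comp] using ht
  · exact exists_fulkersonOutput _ delegationGraph_reach_root
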